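/- Let $(M,\omega)$ be a compact symplectic manifold of dimension $2n$ with a prequantum line bundle $L$ (a Hermitian line bundle with compatible connection of curvature $-i\omega$), and let $(I_\sigma)_{\sigma\in\mathcal T}$ be a smooth family of Kähler structures on $M$ compatible with $\omega$, parametrized by a smooth manifold $\mathcal T$ (Hausdorff, second countable, finite-dimensional). For $\sigma\in\mathcal T$ let $\star_\sigma$ be the Berezin–Toeplitz star product of $(M,\omega,I_\sigma)$: the star product $f\star_\sigma g=\sum_{l\ge 0}c^l_\sigma(f,g)h^l$ on $C_h^\infty(M)=C^\infty(M)[[h]]$ such that, for all $f,g\in C^\infty(M)$ and all $N\ge 1$, $$\Bigl\|T^{(k)}_{f}T^{(k)}_{g}-\sum_{l=0}^{N}k^{-l}\,T^{(k)}_{c^l_\sigma(f,g)}\Bigr\|=O(k^{-(N+1)})\qquad(k\to\infty),$$ where $T^{(k)}_f s=\pi^{(k)}(fs)$ is the Toeplitz operator on $H^0(M_\sigma;L^k)$, $\pi^{(k)}$ is the $L^2$-orthogonal projection onto holomorphic sections and the norm is the operator norm on $H^0(M_\sigma;L^k)$. A formal connection is an operator $D_Vf=V[f]+A(V)(f)$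 on smooth sections $f$ of $\mathcal T\times C_h^\infty(M)\to\mathcal T$, for $V$ a smooth vector field on $\mathcal T$, where $A=\sum_{k\ge1}A^kh^k$ and each $A^k$ is a smooth $1$-form on $\mathcal T$ with values in differential operators on $M$. A formal Hitchin connection is a formal connection that is flat ($D_VD_W-D_WD_V-D_{[V,W]}=0$) and compatible with the family $(\star_\sigma)$, i.e. for all smooth sections $f,g$ the product $f\star_\sigma g$ is again a smooth section and $D_V(f\star_\sigma g)=D_V(f)\star_\sigma g+f\star_\sigma D_V(g)$. Suppose that $H^1(\mathcal T,\mathbb R)=0$. Then a formal Hitchin connection is unique up to gauge equivalence: for any two formal Hitchin connections $D,D'$ there is a smooth map $P=\sum_{k\ge0}P_kh^k$ from $\mathcal T$ to formal differential operators on $M$ with $P_0=\mathrm{id}$ and $P_\sigma(f\star_\sigma g)=P_\sigma(f)\star_\sigma P_\sigma(g)$ for all $\sigma\in\mathcal T$ and $f,g\in C_h^\infty(M)$, such that $D'_V=P^{-1}D_VP$ for every smooth vector field $V$ on $\mathcal T$. -/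

import Mathlib

open scoped Manifold ContDiff Topology
open Filter MeasureTheory

namespace FormalHitchin

noncomputable section

/-! ### Vector fields and first de Rham cohomology -/

section Forms

variable (E : Type*) [NormedAddCommGroup E] [NormedSpace ℝ E]
  (N : Type*) [TopologicalSpace N] [ChartedSpace E N]

/-- Smooth real vector fields on a manifold `N` modelled on `E`. -/
structure SmoothVectorField [IsManifold 𝓘(ℝ, E) ∞ N] where
  toFun : ∀ x : N, TangentSpace 𝓘(ℝ, E) x
  smooth : ContMDiff 𝓘(ℝ, E) 𝓘(ℝ, E).tangent ∞
    (fun x : N => (⟨x, toFun x⟩ : TangentBundle 𝓘(ℝ, E) N))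

instance [IsManifold 𝓘(ℝ, E) ∞ N] : CoeFun (SmoothVectorField E N)
    (fun _ => ∀ x : N, TangentSpace 𝓘(ℝ, E) x) := ⟨SmoothVectorField.toFun⟩

/-- The Lie bracket of two smooth vector fields. -/
def SmoothVectorField.bracket {E : Type*} [NormedAddCommGroup E] [NormedSpace ℝ E]
    [FiniteDimensional ℝ E] {N : Type*} [TopologicalSpace N] [ChartedSpace E N]
    [IsManifold 𝓘(ℝ, E) ∞ N] (V W : SmoothVectorField E N) : SmoothVectorField E N where
  toFun := VectorField.mlieBracket 𝓘(ℝ, E) V W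
  smooth := by
    have : CompleteSpace E := FiniteDimensional.complete ℝ E
    have : IsManifold 𝓘(ℝ, E) (((⊤ : ℕ∞) : WithTop ℕ∞) + 1) N := by
      simpa using (inferInstance : IsManifold 𝓘(ℝ, E) ∞ N)
    have : IsManifold 𝓘(ℝ, E) (minSmoothness ℝ 2) N := by
      simpa using IsManifold.of_le (m := 2) (n := ∞) (I := 𝓘(ℝ, E)) (M := N) (WithTop.coe_le_coe.2 le_top)
    have : IsManifold 𝓘(ℝ, E) (minSmoothness ℝ 3) N := by
      simpa using IsManifold.of_le (m := 3) (n := ∞) (I := 𝓘(ℝ, E)) (M := N) (WithTop.coe_le_coe.2 le_top)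
    exact ContDiff.mlieBracket_vectorField (m := ⊤) (n := ⊤) V.smooth W.smooth (by simp)

/-- Families of covectors, one at every point of `N` (no regularity). -/
def CovectorFamily := ∀ x : N, TangentSpace 𝓘(ℝ, E) x →L[ℝ] ℝ

instance : AddCommGroup (CovectorFamily E N) :=
  inferInstanceAs (AddCommGroup (∀ x : N, TangentSpace 𝓘(ℝ, E) x →L[ℝ] ℝ))

instance : Module ℝ (CovectorFamily E N) :=
  inferInstanceAs (Module ℝ (∀ x : N, TangentSpace 𝓘(ℝ, E) x →L[ℝ] ℝ))

variable {E N} in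
theorem CovectorFamily.add_apply (α β : CovectorFamily E N) (x : N) (v : TangentSpace 𝓘(ℝ, E) x) :
    (α + β) x v = α x v + β x v := rfl

variable {E N} in
theorem CovectorFamily.smul_apply (c : ℝ) (α : CovectorFamily E N) (x : N)
    (v : TangentSpace 𝓘(ℝ, E) x) : (c • α) x v = c * α x v := rfl

variable {E N} in
theorem CovectorFamily.zero_apply (x : N) (v : TangentSpace 𝓘(ℝ, E) x) :
    (0 : CovectorFamily E N) x v = 0 := rfl

variable [IsManifold 𝓘(ℝ, E) ∞ N]

variable {E N} in
/-- `α` is a smooth `1`-form: `α(V)` is a smooth function for every smooth vector field `V`. -/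
def IsSmoothForm (α : CovectorFamily E N) : Prop :=
  ∀ V : SmoothVectorField E N, ContMDiff 𝓘(ℝ, E) 𝓘(ℝ, ℝ) ∞ (fun x => α x (V x))

variable {E N} in
/-- `dα = 0`, where `dα(V, W) = V[α(W)] - W[α(V)] - α([V, W])`. -/
def IsClosedForm (α : CovectorFamily E N) : Prop :=
  ∀ (V W : SmoothVectorField E N) (x : N),
    mvfderiv 𝓘(ℝ, E) (fun y => α y (W y)) x (V x) - mvfderiv 𝓘(ℝ, E) (fun y => α y (V y)) x (W x)
      - α x (VectorField.mlieBracket 𝓘(ℝ, E) V W x) = 0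

/-- The space `Z¹` of smooth closed `1`-forms. -/
def closedForms : Submodule ℝ (CovectorFamily E N) where
  carrier := {α | IsSmoothForm α ∧ IsClosedForm α}
  zero_mem' := by
    refine ⟨fun V => ?_, fun V W x => ?_⟩
    · simpa [CovectorFamily.zero_apply] using contMDiff_const
    · simp [CovectorFamily.zero_apply, mvfderiv_const]
  add_mem' := by
    rintro α β ⟨ha, ha'⟩ ⟨hb, hb'⟩
    refine ⟨fun V => ?_, fun V W x => ?_⟩
    · exact (ha V).add (hb V)
    · have h1 := ha' V W x
      have h2 := hb' V W x
      have e : ∀ V : SmoothVectorField E N, mvfderiv 𝓘(ℝ, E) (fun y => (α + β) y (V y)) x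
          = mvfderiv 𝓘(ℝ, E) (fun y => α y (V y)) x + mvfderiv 𝓘(ℝ, E) (fun y => β y (V y)) x :=
        fun V => mvfderiv_add ((ha V).mdifferentiable (by simp) x)
          ((hb V).mdifferentiable (by simp) x)
      rw [e V, e W]
      simp only [CovectorFamily.add_apply, _root_.add_apply]
      linarith
  smul_mem' := by
    rintro c α ⟨ha, ha'⟩
    refine ⟨fun V => ?_, fun V W x => ?_⟩
    · exact contMDiff_const.mul (ha V)
    · have h1 := ha' V W x
      have e : ∀ V : SmoothVectorField E N, mvfderiv 𝓘(ℝ, E) (fun y => (c • α) y (V y)) x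
          = c • mvfderiv 𝓘(ℝ, E) (fun y => α y (V y)) x := by
        intro V
        have := mvfderiv_mul (I := 𝓘(ℝ, E)) (f := fun _ : N => c) (x := x)
          (g := fun y => α y (V y)) mdifferentiableAt_const
          ((ha V).mdifferentiable (by simp) x)
        rw [mvfderiv_const] at this
        simpa [Pi.mul_def, CovectorFamily.smul_apply] using this
      rw [e V, e W]
      simp only [CovectorFamily.smul_apply, _root_.smul_apply, smul_eq_mul]
      linear_combination c * h1

/-- The space `B¹` of exact `1`-forms `dg`, for `g` a smooth function. -/
def exactForms : Submodule ℝ (CovectorFamily E N) where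
  carrier := {α | ∃ g : N → ℝ, ContMDiff 𝓘(ℝ, E) 𝓘(ℝ, ℝ) ∞ g ∧
    ∀ (x : N) (v : TangentSpace 𝓘(ℝ, E) x), α x v = mvfderiv 𝓘(ℝ, E) g x v}
  zero_mem' := ⟨fun _ => 0, contMDiff_const, fun x v => by
    simp [CovectorFamily.zero_apply, mvfderiv_const]⟩
  add_mem' := by
    rintro α β ⟨g, hg, hg'⟩ ⟨k, hk, hk'⟩
    refine ⟨g + k, hg.add hk, fun x v => ?_⟩
    rw [mvfderiv_add (hg.mdifferentiable (by simp) x) (hk.mdifferentiable (by simp) x)]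
    simp [CovectorFamily.add_apply, hg', hk']
  smul_mem' := by
    rintro c α ⟨g, hg, hg'⟩
    refine ⟨fun x => c * g x, contMDiff_const.mul hg, fun x v => ?_⟩
    have := mvfderiv_mul (I := 𝓘(ℝ, E)) (f := fun _ : N => c) (x := x) (g := g)
      mdifferentiableAt_const (hg.mdifferentiable (by simp) x)
    rw [mvfderiv_const] at this
    have h2 : mvfderiv 𝓘(ℝ, E) (fun x => c * g x) x = c • mvfderiv 𝓘(ℝ, E) g x := by
      simpa [Pi.mul_def] using this
    rw [h2]
    simp [CovectorFamily.smul_apply, hg']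

/-- The first de Rham cohomology group `H¹(N, ℝ) = Z¹ / B¹`. -/
abbrev deRhamH1 : Type _ :=
  closedForms E N ⧸ (exactForms E N).comap (closedForms E N).subtype

end Forms

/-! ### Smooth complex functions, smooth families of them, differential operators -/

section Functions

variable (E : Type*) [NormedAddCommGroup E] [NormedSpace ℝ E]
  (M : Type*) [TopologicalSpace M] [ChartedSpace E M]

/-- `C^∞(M)`: the `ℂ`-algebra of smooth complex-valued functions on `M`. -/
def SmoothFun : Subalgebra ℂ (M → ℂ) where
  carrier := {f | ContMDiff 𝓘(ℝ, E) 𝓘(ℝ, ℂ) ∞ f}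
  mul_mem' := fun {f g} hf hg => by
    exact (contDiff_mul (𝕜 := ℝ) (𝔸 := ℂ)).contMDiff.comp (hf.prodMk_space hg)
  add_mem' := fun {f g} hf hg => hf.add hg
  algebraMap_mem' := fun c => contMDiff_const

/-- Formal functions `C^∞(M)[[h]]`. -/
abbrev FormalFun := PowerSeries (SmoothFun E M)

variable {E M}

/-- Differential operators on `C^∞(M)` of order at most `N`, in the algebraic description: all
`(N + 1)`-fold iterated commutators with multiplication operators vanish. -/
def IsDiffOp : ℕ → Module.End ℂ (SmoothFun E M) → Prop
  | 0, P => ∀ g : SmoothFun E M,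
      P * LinearMap.mulLeft ℂ g - LinearMap.mulLeft ℂ g * P = 0
  | N + 1, P => ∀ g : SmoothFun E M,
      IsDiffOp N (P * LinearMap.mulLeft ℂ g - LinearMap.mulLeft ℂ g * P)

/-- The `ℂ[[h]]`-linear action of a formal operator `∑ P_k h^k` on formal functions. -/
def formalApply (P : ℕ → Module.End ℂ (SmoothFun E M)) (f : FormalFun E M) : FormalFun E M :=
  PowerSeries.mk fun n => ∑ p ∈ Finset.HasAntidiagonal.antidiagonal n, P p.1 (PowerSeries.coeff p.2 f)

/-- The `ℂ[[h]]`-bilinear product on formal functions with coefficients `c k`. -/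
def formalMul (c : ℕ → SmoothFun E M →ₗ[ℂ] SmoothFun E M →ₗ[ℂ] SmoothFun E M)
    (f g : FormalFun E M) : FormalFun E M :=
  PowerSeries.mk fun n => ∑ p ∈ Finset.HasAntidiagonal.antidiagonal n, ∑ q ∈ Finset.HasAntidiagonal.antidiagonal p.2,
    c p.1 (PowerSeries.coeff q.1 f) (PowerSeries.coeff q.2 g)

end Functions

section Families

variable {F : Type*} [NormedAddCommGroup F] [NormedSpace ℝ F]
  {T : Type*} [TopologicalSpace T] [ChartedSpace F T]
  {E : Type*} [NormedAddCommGroup E] [NormedSpace ℝ E]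
  {M : Type*} [TopologicalSpace M] [ChartedSpace E M]

variable (F) in
/-- A smooth map `T → C^∞(M)`, i.e. one for which `(σ, x) ↦ f_σ(x)` is smooth on `T × M`. -/
def IsSmoothFamily (f : T → SmoothFun E M) : Prop :=
  ContMDiff (𝓘(ℝ, F).prod 𝓘(ℝ, E)) 𝓘(ℝ, ℂ) ∞ (fun p : T × M => (f p.1 : M → ℂ) p.2)

theorem isSmoothFamily_add {f g : T → SmoothFun E M} (hf : IsSmoothFamily F f)
    (hg : IsSmoothFamily F g) : IsSmoothFamily F (fun σ => f σ + g σ) := hf.add hg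

theorem isSmoothFamily_sum {α : Type*} (s : Finset α) {f : α → T → SmoothFun E M}
    (hf : ∀ a ∈ s, IsSmoothFamily F (f a)) : IsSmoothFamily F (fun σ => ∑ a ∈ s, f a σ) := by
  classical
  induction s using Finset.induction_on with
  | empty => simpa [IsSmoothFamily] using contMDiff_const
  | insert a s ha ih =>
    simp only [Finset.sum_insert ha]
    exact isSmoothFamily_add (hf a (by simp)) (ih fun b hb => hf b (by simp [hb]))

variable [IsManifold 𝓘(ℝ, F) ∞ T] [IsManifold 𝓘(ℝ, E) ∞ M]

/-- `(σ, x) ↦ V[f]_σ(x)` is smooth on `T × M`, for a smooth map `f : T → C^∞(M)`. -/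
theorem contMDiff_derivAlong (V : SmoothVectorField F T) {f : T → SmoothFun E M}
    (hf : IsSmoothFamily F f) :
    ContMDiff (𝓘(ℝ, F).prod 𝓘(ℝ, E)) 𝓘(ℝ, ℂ) ∞
      (fun p : T × M => mvfderiv 𝓘(ℝ, F) (fun τ => (f τ : M → ℂ) p.2) p.1 (V p.1)) := by
  have S₁ : ContMDiff (𝓘(ℝ, F).prod 𝓘(ℝ, E)) (𝓘(ℝ, F).tangent.prod 𝓘(ℝ, E).tangent) ∞
      (fun p : T × M => ((⟨p.1, V p.1⟩ : TangentBundle 𝓘(ℝ, F) T),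
        (⟨p.2, 0⟩ : TangentBundle 𝓘(ℝ, E) M))) :=
    (V.smooth.comp contMDiff_fst).prodMk
      ((Bundle.contMDiff_zeroSection ℝ (TangentSpace 𝓘(ℝ, E) : M → Type _)).comp contMDiff_snd)
  have S₂ := (contMDiff_equivTangentBundleProd_symm (n := ∞) (I := 𝓘(ℝ, F)) (I' := 𝓘(ℝ, E))
    (M := T) (M' := M)).comp S₁
  have S₃ := (hf.contMDiff_tangentMap (m := ∞) (by simp)).comp S₂
  have S₄ := (contMDiff_snd_tangentBundle_modelSpace ℂ 𝓘(ℝ, ℂ) (n := ∞)).comp S₃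
  convert! S₄ using 1
  ext p
  have hd := hf.mdifferentiable (by simp) p
  have key := mfderiv_prod_eq_add_apply (v := ((V p.1, 0) :
    TangentSpace (𝓘(ℝ, F).prod 𝓘(ℝ, E)) p)) hd
  change (mfderiv 𝓘(ℝ, F) 𝓘(ℝ, ℂ) (fun z => (f z : M → ℂ) p.2) p.1 (V p.1) : ℂ) =
    mfderiv (𝓘(ℝ, F).prod 𝓘(ℝ, E)) 𝓘(ℝ, ℂ) (fun p : T × M => (f p.1 : M → ℂ) p.2) p
      ((V p.1, 0) : TangentSpace (𝓘(ℝ, F).prod 𝓘(ℝ, E)) p)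
  rw [key]
  exact (congrArg (_ + ·) (map_zero _)).trans (add_zero _) |>.symm

/-- The derivative `V[f]` of a smooth map `f : T → C^∞(M)` along a vector field on `T`. -/
def derivAlong (V : SmoothVectorField F T) (f : T → SmoothFun E M) (hf : IsSmoothFamily F f)
    (σ : T) : SmoothFun E M :=
  ⟨fun x => mvfderiv 𝓘(ℝ, F) (fun τ => (f τ : M → ℂ) x) σ (V σ),
    (contMDiff_derivAlong V hf).comp (contMDiff_const.prodMk contMDiff_id)⟩

variable (F T E M) in
/-- Smooth sections of the trivial bundle `T × C^∞(M)[[h]] → T`. -/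
structure FormalSection where
  toFun : T → FormalFun E M
  smooth : ∀ n, IsSmoothFamily F (fun σ => PowerSeries.coeff n (toFun σ))

instance : CoeFun (FormalSection F T E M) (fun _ => T → FormalFun E M) := ⟨FormalSection.toFun⟩

variable (F T E M) in
/-- A formal connection `D_V f = V[f] + A(V)(f)`: here `A = ∑ A^k h^k` is a smooth `1`-form on `T`
with values in formal differential operators on `M` such that `A = 0` modulo `h`.  Smoothness of
`A^k` means that the differential order is bounded locally on `T` and that `A^k(V)(f)` is a smooth
map `T → C^∞(M)` whenever `V` is a smooth vector field on `T` and `f : T → C^∞(M)` is smooth. -/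
structure FormalConnection where
  A : ∀ σ : T, TangentSpace 𝓘(ℝ, F) σ →ₗ[ℝ] (ℕ → Module.End ℂ (SmoothFun E M))
  A_zero : ∀ σ v, A σ v 0 = 0
  isDiffOp : ∀ (k : ℕ) (σ₀ : T), ∃ N : ℕ, ∀ᶠ σ in 𝓝 σ₀, ∀ v, IsDiffOp N (A σ v k)
  smooth : ∀ (k : ℕ) (V : SmoothVectorField F T) (f : T → SmoothFun E M),
    IsSmoothFamily F f → IsSmoothFamily F (fun σ => A σ (V σ) k (f σ))

/-- The covariant derivative `D_V f = V[f] + A(V)(f)` of a smooth section. -/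
def FormalConnection.covDeriv (D : FormalConnection F T E M) (V : SmoothVectorField F T)
    (f : FormalSection F T E M) : FormalSection F T E M where
  toFun σ := PowerSeries.mk (fun n => derivAlong V (fun τ => PowerSeries.coeff n (f τ)) (f.smooth n) σ)
    + formalApply (D.A σ (V σ)) (f σ)
  smooth n := by
    simp only [map_add, PowerSeries.coeff_mk, formalApply]
    exact isSmoothFamily_add (contMDiff_derivAlong V (f.smooth n))
      (isSmoothFamily_sum _ fun p _ => D.smooth p.1 V _ (f.smooth p.2))

/-- Flatness: `D_V D_W - D_W D_V - D_{[V, W]} = 0`. -/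
def FormalConnection.IsFlat [FiniteDimensional ℝ F] (D : FormalConnection F T E M) : Prop :=
  ∀ (V W : SmoothVectorField F T) (f : FormalSection F T E M) (σ : T),
    D.covDeriv V (D.covDeriv W f) σ - D.covDeriv W (D.covDeriv V f) σ
      - D.covDeriv (V.bracket W) f σ = 0

end Families

/-! ### Symplectic manifolds, star products -/

section Symplectic

variable (E : Type*) [NormedAddCommGroup E] [NormedSpace ℝ E]
  (M : Type*) [TopologicalSpace M] [ChartedSpace E M] [IsManifold 𝓘(ℝ, E) ∞ M]

/-- Symplectic forms on `M`: smooth, closed, nondegenerate `2`-forms. -/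
structure SymplecticForm where
  toFun : ∀ x : M, TangentSpace 𝓘(ℝ, E) x →ₗ[ℝ] TangentSpace 𝓘(ℝ, E) x →ₗ[ℝ] ℝ
  alt : ∀ x v, toFun x v v = 0
  nondegenerate : ∀ x v, (∀ w, toFun x v w = 0) → v = 0
  smooth : ∀ X Y : SmoothVectorField E M,
    ContMDiff 𝓘(ℝ, E) 𝓘(ℝ, ℝ) ∞ (fun x => toFun x (X x) (Y x))
  closed : ∀ (X Y Z : SmoothVectorField E M) (x : M),
    mvfderiv 𝓘(ℝ, E) (fun y => toFun y (Y y) (Z y)) x (X x)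
      - mvfderiv 𝓘(ℝ, E) (fun y => toFun y (X y) (Z y)) x (Y x)
      + mvfderiv 𝓘(ℝ, E) (fun y => toFun y (X y) (Y y)) x (Z x)
      - toFun x (VectorField.mlieBracket 𝓘(ℝ, E) X Y x) (Z x)
      + toFun x (VectorField.mlieBracket 𝓘(ℝ, E) X Z x) (Y x)
      - toFun x (VectorField.mlieBracket 𝓘(ℝ, E) Y Z x) (X x) = 0

variable {E M}

instance : CoeFun (SymplecticForm E M)
    (fun _ => ∀ x : M, TangentSpace 𝓘(ℝ, E) x →ₗ[ℝ] TangentSpace 𝓘(ℝ, E) x →ₗ[ℝ] ℝ) :=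
  ⟨SymplecticForm.toFun⟩

/-- The Hamiltonian vector `X_u(x)` of a real function `u`: the vector with `Ω(X_u, ·) = du`. -/
def SymplecticForm.hamiltonian (Ω : SymplecticForm E M) (u : M → ℝ) (x : M) :
    TangentSpace 𝓘(ℝ, E) x :=
  Function.invFun (fun v => Ω x v) (mvfderiv 𝓘(ℝ, E) u x).toLinearMap

/-- The Poisson bracket `{f, g} = dg(X_f)`, extended complex-bilinearly to complex functions.
It is the bracket of the bivector `Ω⁻¹` normalised by `Ω · Ω⁻¹ = id`; for `Ω = dx ∧ dy` one has
`{x, y} = -1`. -/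
def SymplecticForm.poisson (Ω : SymplecticForm E M) (f g : M → ℂ) (x : M) : ℂ :=
  mvfderiv 𝓘(ℝ, E) g x (Ω.hamiltonian (fun y => (f y).re) x)
    + Complex.I * mvfderiv 𝓘(ℝ, E) g x (Ω.hamiltonian (fun y => (f y).im) x)

/-- Star products on `(M, Ω)`, given by their coefficients `c^k`. -/
structure StarProduct (Ω : SymplecticForm E M) where
  coeff : ℕ → SmoothFun E M →ₗ[ℂ] SmoothFun E M →ₗ[ℂ] SmoothFun E M
  assoc : ∀ f g k : FormalFun E M,
    formalMul coeff (formalMul coeff f g) k = formalMul coeff f (formalMul coeff g k)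
  mul_one : ∀ f : FormalFun E M, formalMul coeff f 1 = f
  one_mul : ∀ f : FormalFun E M, formalMul coeff 1 f = f
  coeff_zero : ∀ f g : SmoothFun E M, coeff 0 f g = f * g
  coeff_one : ∀ (f g : SmoothFun E M) (x : M),
    (coeff 1 f g : M → ℂ) x - (coeff 1 g f : M → ℂ) x = Complex.I * Ω.poisson f g x

/-- The product `f ⋆ g` of formal functions. -/
def StarProduct.mul {Ω : SymplecticForm E M} (S : StarProduct Ω) (f g : FormalFun E M) :
    FormalFun E M := formalMul S.coeff f g

/-- `J` is an integrable almost complex structure compatible with `Ω`, so that `(M, Ω, J)` is a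
Kähler manifold with metric `Ω(·, J ·)`. -/
structure IsKahler (Ω : SymplecticForm E M)
    (J : ∀ x : M, TangentSpace 𝓘(ℝ, E) x →ₗ[ℝ] TangentSpace 𝓘(ℝ, E) x) : Prop where
  sq : ∀ x v, J x (J x v) = -v
  compatible : ∀ x v w, Ω x (J x v) (J x w) = Ω x v w
  pos : ∀ x v, v ≠ 0 → 0 < Ω x v (J x v)
  integrable : ∀ (X Y : SmoothVectorField E M) (x : M),
    VectorField.mlieBracket 𝓘(ℝ, E) (fun y => J y (X y)) (fun y => J y (Y y)) x
      - J x (VectorField.mlieBracket 𝓘(ℝ, E) (fun y => J y (X y)) Y x)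
      - J x (VectorField.mlieBracket 𝓘(ℝ, E) X (fun y => J y (Y y)) x)
      - VectorField.mlieBracket 𝓘(ℝ, E) X Y x = 0

/-- Smooth families of compatible Kähler structures on `(M, Ω)` parametrised by `T`. -/
structure KahlerFamily (Ω : SymplecticForm E M)
    (F : Type*) [NormedAddCommGroup F] [NormedSpace ℝ F]
    (T : Type*) [TopologicalSpace T] [ChartedSpace F T] where
  J : T → ∀ x : M, TangentSpace 𝓘(ℝ, E) x →ₗ[ℝ] TangentSpace 𝓘(ℝ, E) x
  smooth : ∀ X : SmoothVectorField E M,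
    ContMDiff (𝓘(ℝ, F).prod 𝓘(ℝ, E)) 𝓘(ℝ, E).tangent ∞
      (fun p : T × M => (⟨p.2, J p.1 p.2 (X p.2)⟩ : TangentBundle 𝓘(ℝ, E) M))
  isKahler : ∀ σ, IsKahler Ω (J σ)

/-- A prequantum line bundle of `(M, Ω)`: a Hermitian line bundle `L` with a compatible connection of
curvature `-iΩ`, described in local unitary frames over an open cover `U i`.  The `g i j` are the
`U(1)`-valued transition functions; a section is a family of local functions `s i` with
`s i = g i j * s j`, and `∇ s` is given by `d(s i) - i θ_i (s i)` with real forms `θ_i`. -/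
structure PrequantumBundle (Ω : SymplecticForm E M) (ι : Type*) where
  U : ι → Set M
  isOpen : ∀ i, IsOpen (U i)
  indexAt : M → ι
  mem_indexAt : ∀ x, x ∈ U (indexAt x)
  g : ι → ι → M → ℂ
  g_smooth : ∀ i j, ContMDiffOn 𝓘(ℝ, E) 𝓘(ℝ, ℂ) ∞ (g i j) (U i ∩ U j)
  g_norm : ∀ i j, ∀ x ∈ U i ∩ U j, ‖g i j x‖ = 1
  g_cocycle : ∀ i j k, ∀ x ∈ U i ∩ U j ∩ U k, g i j x * g j k x = g i k x
  θ : ι → CovectorFamily E M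
  θ_smooth : ∀ (i : ι) (X : SmoothVectorField E M),
    ContMDiffOn 𝓘(ℝ, E) 𝓘(ℝ, ℝ) ∞ (fun x => θ i x (X x)) (U i)
  θ_transition : ∀ i j, ∀ x ∈ U i ∩ U j, ∀ v : TangentSpace 𝓘(ℝ, E) x,
    mvfderiv 𝓘(ℝ, E) (g i j) x v = Complex.I * ((θ i x v - θ j x v : ℝ) : ℂ) * g i j x
  curvature : ∀ (i : ι) (X Y : SmoothVectorField E M), ∀ x ∈ U i,
    mvfderiv 𝓘(ℝ, E) (fun y => θ i y (Y y)) x (X x)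
      - mvfderiv 𝓘(ℝ, E) (fun y => θ i y (X y)) x (Y x)
      - θ i x (VectorField.mlieBracket 𝓘(ℝ, E) X Y x) = Ω x (X x) (Y x)

namespace PrequantumBundle

variable {Ω : SymplecticForm E M} {ι : Type*} (L : PrequantumBundle Ω ι)

/-- `s` is a smooth section of `L^k` (by convention `s i` is extended by zero outside `U i`). -/
structure IsSection (k : ℕ) (s : ι → M → ℂ) : Prop where
  smooth : ∀ i, ContMDiffOn 𝓘(ℝ, E) 𝓘(ℝ, ℂ) ∞ (s i) (L.U i)
  transition : ∀ i j, ∀ x ∈ L.U i ∩ L.U j, s i x = L.g i j x ^ k * s j x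
  eq_zero : ∀ i, ∀ x ∉ L.U i, s i x = 0

/-- The covariant derivative `∇_v s` on `L^k` in the frame `i`. -/
def nabla (k : ℕ) (s : ι → M → ℂ) (i : ι) (x : M) (v : TangentSpace 𝓘(ℝ, E) x) : ℂ :=
  mvfderiv 𝓘(ℝ, E) (s i) x v - Complex.I * k * (L.θ i x v : ℝ) * s i x

/-- `s ∈ H⁰(M_J, L^k)`: `s` is a smooth section of `L^k` with `∇_{X''} s = 0` for all vectors `X`,
where `X'' = (X + i J X) / 2`. -/
def IsHolomorphic (J : ∀ x : M, TangentSpace 𝓘(ℝ, E) x →ₗ[ℝ] TangentSpace 𝓘(ℝ, E) x) (k : ℕ)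
    (s : ι → M → ℂ) : Prop :=
  L.IsSection k s ∧ ∀ i, ∀ x ∈ L.U i, ∀ v : TangentSpace 𝓘(ℝ, E) x,
    L.nabla k s i x v + Complex.I * L.nabla k s i x (J x v) = 0

end PrequantumBundle

end Symplectic

/-! ### Berezin-Toeplitz quantization of compact Kähler manifolds -/

section Toeplitz

variable {d : ℕ} {M : Type*} [TopologicalSpace M] [ChartedSpace (EuclideanSpace ℝ (Fin d)) M]
  [IsManifold (𝓡 d) ∞ M] [MeasurableSpace M] [BorelSpace M]

/-- The matrix of `Ω` in the chart `e` at the point with coordinates `y`. -/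
def SymplecticForm.chartMatrix (Ω : SymplecticForm (EuclideanSpace ℝ (Fin d)) M)
    (e : OpenPartialHomeomorph M (EuclideanSpace ℝ (Fin d))) (y : EuclideanSpace ℝ (Fin d)) :
    Matrix (Fin d) (Fin d) ℝ :=
  Matrix.of fun i j => Ω (e.symm y)
    (mfderiv (𝓡 d) (𝓡 d) e.symm y (EuclideanSpace.single i (1 : ℝ)))
    (mfderiv (𝓡 d) (𝓡 d) e.symm y (EuclideanSpace.single j (1 : ℝ)))

/-- The Liouville measure, i.e. the measure of the volume form `Ω^n / n!`.  On a chart domain it has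
density `√det(Ω_ij)` with respect to Lebesgue measure; the measure on `M` is the supremum of these
(mutually compatible) measures over chart domains. -/
def SymplecticForm.liouville (Ω : SymplecticForm (EuclideanSpace ℝ (Fin d)) M) : Measure M :=
  ⨆ x : M, (((volume.restrict (chartAt (EuclideanSpace ℝ (Fin d)) x).target).withDensity
    (fun y => ENNReal.ofReal
      (Real.sqrt (Ω.chartMatrix (chartAt (EuclideanSpace ℝ (Fin d)) x) y).det))).map
    (chartAt (EuclideanSpace ℝ (Fin d)) x).symm)

namespace PrequantumBundle

variable {Ω : SymplecticForm (EuclideanSpace ℝ (Fin d)) M} {ι : Type*} (L : PrequantumBundle Ω ι)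

/-- The `L²` inner product of two sections of `L^k`; the integrand is the pointwise Hermitian
product and does not depend on the choice of frame. -/
def innerL2 (s t : ι → M → ℂ) : ℂ :=
  ∫ x, (starRingEnd ℂ) (s (L.indexAt x) x) * t (L.indexAt x) x ∂Ω.liouville

/-- The `L²` norm of a section of `L^k`. -/
def normL2 (s : ι → M → ℂ) : ℝ := Real.sqrt (L.innerL2 s s).re

variable (J : ∀ x : M, TangentSpace (𝓡 d) x →ₗ[ℝ] TangentSpace (𝓡 d) x)

open Classical in
/-- The orthogonal projection `π^{(k)}` of a section of `L^k` to the space `H⁰(M_J, L^k)`, which is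
finite-dimensional when `M` is compact, so that the projection exists and is unique. -/
def holProj (k : ℕ) (s : ι → M → ℂ) : ι → M → ℂ :=
  if h : ∃ t, L.IsHolomorphic J k t ∧
      ∀ u, L.IsHolomorphic J k u → L.innerL2 u t = L.innerL2 u s
  then h.choose else 0

/-- The Toeplitz operator `T_f^{(k)} s = π^{(k)}(f s)`. -/
def toeplitz (k : ℕ) (f : SmoothFun (EuclideanSpace ℝ (Fin d)) M) (s : ι → M → ℂ) : ι → M → ℂ :=
  L.holProj J k (fun i x => (f : M → ℂ) x * s i x)

/-- `S` is the Berezin-Toeplitz star product of the Kähler manifold `(M, Ω, J)`: for every positive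
integer `N`, in operator norm on `H⁰(M_J, L^k)`,
`‖T_f T_g - ∑_{l ≤ N} k^{-l} T_{c^l(f, g)}‖ = O(k^{-(N + 1)})` as `k → ∞`. -/
def IsBerezinToeplitz (S : StarProduct Ω) : Prop :=
  ∀ (f g : SmoothFun (EuclideanSpace ℝ (Fin d)) M) (N : ℕ), 1 ≤ N →
    ∃ C : ℝ, ∀ᶠ k : ℕ in atTop, ∀ s, L.IsHolomorphic J k s →
      L.normL2 (L.toeplitz J k f (L.toeplitz J k g s)
        - ∑ l ∈ Finset.range (N + 1), ((k : ℂ) ^ l)⁻¹ • L.toeplitz J k (S.coeff l f g) s)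
      ≤ C * ((k : ℝ) ^ (N + 1))⁻¹ * L.normL2 s

end PrequantumBundle

end Toeplitz

/-! ### Formal Hitchin connections and gauge equivalence -/

section Hitchin

variable {F : Type*} [NormedAddCommGroup F] [NormedSpace ℝ F]
  {T : Type*} [TopologicalSpace T] [ChartedSpace F T] [IsManifold 𝓘(ℝ, F) ∞ T]
  {E : Type*} [NormedAddCommGroup E] [NormedSpace ℝ E]
  {M : Type*} [TopologicalSpace M] [ChartedSpace E M] [IsManifold 𝓘(ℝ, E) ∞ M]
  {Ω : SymplecticForm E M}

/-- `D` is compatible with the family of star products: for smooth sections `f, g` also `f ⋆ g` is a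
smooth section, and `D_V (f ⋆ g) = D_V f ⋆ g + f ⋆ D_V g`. -/
def FormalConnection.IsCompatible (D : FormalConnection F T E M) (star : T → StarProduct Ω) : Prop :=
  ∀ f g : FormalSection F T E M, ∃ fg : FormalSection F T E M,
    (∀ σ, fg σ = (star σ).mul (f σ) (g σ)) ∧
    ∀ (V : SmoothVectorField F T) (σ : T), D.covDeriv V fg σ =
      (star σ).mul (D.covDeriv V f σ) (g σ) + (star σ).mul (f σ) (D.covDeriv V g σ)

variable (F) in
/-- Self-equivalences of a family of star products: smooth maps `P = ∑ P_k h^k` from `T` to formal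
differential operators on `M` with `P = id` modulo `h` and `P_σ(f ⋆_σ g) = P_σ(f) ⋆_σ P_σ(g)`. -/
structure SelfEquivalence (star : T → StarProduct Ω) where
  P : T → ℕ → Module.End ℂ (SmoothFun E M)
  P_zero : ∀ σ, P σ 0 = 1
  isDiffOp : ∀ (k : ℕ) (σ₀ : T), ∃ N : ℕ, ∀ᶠ σ in 𝓝 σ₀, IsDiffOp N (P σ k)
  smooth : ∀ (k : ℕ) (f : T → SmoothFun E M),
    IsSmoothFamily F f → IsSmoothFamily F (fun σ => P σ k (f σ))
  map_mul : ∀ (σ : T) (f g : FormalFun E M), formalApply (P σ) ((star σ).mul f g) =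
    (star σ).mul (formalApply (P σ) f) (formalApply (P σ) g)

/-- The action of a self-equivalence on smooth sections. -/
def SelfEquivalence.apply {star : T → StarProduct Ω} (P : SelfEquivalence F star)
    (f : FormalSection F T E M) : FormalSection F T E M where
  toFun σ := formalApply (P.P σ) (f σ)
  smooth n := by
    simp only [PowerSeries.coeff_mk, formalApply]
    exact isSmoothFamily_sum _ fun p _ => P.smooth p.1 _ (f.smooth p.2)

/-- `D` and `D'` are gauge equivalent: `D'_V = P⁻¹ D_V P` for all `V`, for a self-equivalence `P` of
the family of star products (which is invertible on smooth sections). -/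
def GaugeEquivalent (star : T → StarProduct Ω) (D D' : FormalConnection F T E M) : Prop :=
  ∃ (P : SelfEquivalence F star) (Pinv : FormalSection F T E M → FormalSection F T E M),
    Function.LeftInverse Pinv P.apply ∧ Function.RightInverse Pinv P.apply ∧
    ∀ (V : SmoothVectorField F T) (f : FormalSection F T E M),
      D'.covDeriv V f = Pinv (D.covDeriv V (P.apply f))

/-- A flat formal connection that is compatible with the given family of star products. For the
family of Berezin-Toeplitz star products these are the formal Hitchin connections. -/
structure FormalConnection.IsFlatCompatible [FiniteDimensional ℝ F] (D : FormalConnection F T E M)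
    (star : T → StarProduct Ω) : Prop where
  isCompatible : D.IsCompatible star
  isFlat : D.IsFlat

end Hitchin

end

end FormalHitchin

set_option linter.unusedSectionVars false

namespace FormalHitchin

noncomputable section

/-! ### Integrals depending on parameters -/

section ParametricIntegral

variable {S : Type*} [NormedAddCommGroup S] [NormedSpace ℝ S] [FiniteDimensional ℝ S]
  {Y : Type*} [NormedAddCommGroup Y] [NormedSpace ℝ Y] [CompleteSpace Y]

/-! A flat formal connection `D = d + A` is trivialised by formal parallel transport. Fix a base
point in every component of `T` and look for `G = ∑ G_n h^n` with `dG = -A G` and `G = id` at the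
base points. Since `A` vanishes modulo `h`, the coefficient of `h^n` reads `dG_n = -∑ A^i G_j`,
summed over `i + j = n` with `i ≥ 1`, so the right side involves earlier terms only. Flatness says
exactly that this operator-valued form is closed. Applied to a function `g` and evaluated at `x`, it
becomes a closed complex `1`-form on `T`, which has a primitive because `H¹(T, ℝ) = 0`; neither
path-ordered integrals nor simple connectedness are needed (`FormalConnection.negComp_closed`,
`exists_primitive`, `FormalConnection.exists_isTrivialisation`).

If `D` is compatible with the products, the product of two parallel sections is parallel. A parallel
section is determined by its values at the base points, so `G_σ` carries the star product at the
base point of the component of `σ` to `⋆_σ` (`mul_apply`). If `G'` trivialises a second connection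
`D'`, then `P = G G'⁻¹` preserves every `⋆_σ`. As `G⁻¹ D G = d = G'⁻¹ D' G'`, it follows that `D' =
P⁻¹ D P`.

The analytic work is to show that the pointwise primitives form differential operators of locally
bounded order depending smoothly on the parameter (`exists_smoothOpFamily`), and that smoothness on
fixed functions implies smoothness on smooth families (`IsDiffOpLT.isSmoothFamily_apply`).
Differential operators are defined by iterated commutators, so both rest on induction over the
order, the second one with Hadamard's lemma in place of coordinate expressions. -/

theorem hasFDerivAt_parametric_integral {f : S → ℝ → Y} (hf : ContDiff ℝ 1 (Function.uncurry f))
    (s₀ : S) :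
    HasFDerivAt (fun s => ∫ t in (0 : ℝ)..1, f s t)
      (∫ t in (0 : ℝ)..1, fderiv ℝ (fun s => f s t) s₀) s₀ := by
  have hslice : ∀ s, Continuous (f s) := fun s => hf.continuous.comp (Continuous.prodMk_right s)
  have hd : Continuous (fun p : S × ℝ => fderiv ℝ (fun s => f s p.2) p.1) := by
    have : ContDiff ℝ 0 (fun p : S × ℝ => fderiv ℝ (fun s => f s p.2) p.1) := by
      refine ContDiff.fderiv (m := 1) (n := 0) (f := fun (p : S × ℝ) s => f s p.2) ?_
        contDiff_fst (zero_add 1).le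
      exact hf.comp (contDiff_snd.prodMk (contDiff_snd.comp contDiff_fst))
    exact this.continuous
  have : ProperSpace S := FiniteDimensional.proper ℝ S
  -- The dominating function is constant: the derivative is continuous, hence bounded on the compact
  -- product of the unit ball and `[0, 1]`.
  obtain ⟨C, hC⟩ := ((isCompact_closedBall s₀ (1 : ℝ)).prod
    (isCompact_Icc (a := (0 : ℝ)) (b := 1))).exists_bound_of_continuousOn hd.continuousOn
  refine intervalIntegral.hasFDerivAt_integral_of_dominated_of_fderiv_le
    (F' := fun s t => fderiv ℝ (fun s => f s t) s) (bound := fun _ => C)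
    (Metric.closedBall_mem_nhds s₀ one_pos) (Eventually.of_forall fun s =>
      (hslice s).aestronglyMeasurable) ((hslice s₀).intervalIntegrable _ _)
    ((hd.comp (by fun_prop : Continuous fun t : ℝ => (s₀, t))).aestronglyMeasurable) ?_ (by simp) ?_
  · refine Eventually.of_forall fun t ht s hs => ?_
    rw [Set.uIoc_of_le zero_le_one] at ht
    exact hC (s, t) ⟨hs, ⟨ht.1.le, ht.2⟩⟩
  · refine Eventually.of_forall fun t _ s _ => ?_
    have : ContDiff ℝ 1 (fun s => f s t) := hf.comp (contDiff_id.prodMk contDiff_const)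
    exact (this.differentiable (by simp) s).hasFDerivAt

/-- The derivative is again an integral of the same kind. Fixing a direction `y` keeps the values in
`Y`, so the induction hypothesis applies to it directly. -/
theorem contDiff_parametric_integral_nat (n : ℕ) {f : S → ℝ → Y}
    (hf : ContDiff ℝ ∞ (Function.uncurry f)) :
    ContDiff ℝ n (fun s => ∫ t in (0 : ℝ)..1, f s t) := by
  induction n generalizing f with
  | zero =>
    simp only [CharP.cast_eq_zero, contDiff_zero]
    exact intervalIntegral.continuous_parametric_intervalIntegral_of_continuous' hf.continuous _ _
  | succ n ih =>
    push_cast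
    have h1 : ContDiff ℝ 1 (Function.uncurry f) := hf.of_le (by exact_mod_cast le_top)
    have hD : ContDiff ℝ ∞ (fun p : S × ℝ => fderiv ℝ (fun s => f s p.2) p.1) := by
      refine ContDiff.fderiv (m := ∞) (n := ∞) (f := fun (p : S × ℝ) s => f s p.2) ?_
        contDiff_fst (by simp)
      exact hf.comp (contDiff_snd.prodMk (contDiff_snd.comp contDiff_fst))
    rw [contDiff_succ_iff_fderiv_apply]
    refine ⟨fun s => (hasFDerivAt_parametric_integral h1 s).differentiableAt, by simp, fun y => ?_⟩
    have e : (fun s => fderiv ℝ (fun s => ∫ t in (0 : ℝ)..1, f s t) s y) =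
        fun s => ∫ t in (0 : ℝ)..1, fderiv ℝ (fun s => f s t) s y := by
      ext s
      rw [(hasFDerivAt_parametric_integral h1 s).fderiv,
        ContinuousLinearMap.intervalIntegral_apply]
      exact (hD.continuous.comp (by fun_prop : Continuous fun t : ℝ => (s, t))).intervalIntegrable _ _
    rw [e]
    exact ih (f := fun s t => fderiv ℝ (fun s => f s t) s y) (hD.clm_apply contDiff_const)

theorem contDiff_parametric_integral {f : S → ℝ → Y} (hf : ContDiff ℝ ∞ (Function.uncurry f)) :
    ContDiff ℝ ∞ (fun s => ∫ t in (0 : ℝ)..1, f s t) :=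
  contDiff_infty.2 fun n => contDiff_parametric_integral_nat n hf

/-- Hadamard's lemma with parameters. -/
theorem exists_hadamard {E : Type*} [NormedAddCommGroup E] [NormedSpace ℝ E]
    [FiniteDimensional ℝ E] {f : S × E → Y} (hf : ContDiff ℝ ∞ f) :
    ∃ H : S × E × E → E →L[ℝ] Y, ContDiff ℝ ∞ H ∧
      (∀ s u v, f (s, u) - f (s, v) = H (s, u, v) (u - v)) ∧
      ∀ s v, H (s, v, v) = fderiv ℝ (fun e => f (s, e)) v := by
  -- The derivative of `f (s, ·)` on the segment from `v` to `u`; its integral over the segment is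
  -- the Hadamard factor.
  set G : (S × E × E) × ℝ → E →L[ℝ] Y :=
    fun p => fderiv ℝ (fun e => f (p.1.1, e)) (p.1.2.2 + p.2 • (p.1.2.1 - p.1.2.2)) with hG
  have hGs : ContDiff ℝ ∞ G := by
    refine ContDiff.fderiv (m := ∞) (n := ∞) (f := fun (p : (S × E × E) × ℝ) e => f (p.1.1, e)) ?_
      (by fun_prop) (by simp)
    exact hf.comp (by fun_prop)
  refine ⟨fun p => ∫ t in (0 : ℝ)..1, G (p, t),
    contDiff_parametric_integral (f := fun p t => G (p, t)) hGs, fun s u v => ?_, fun s v => ?_⟩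
  · have hc : Continuous fun t : ℝ => G ((s, u, v), t) := hGs.continuous.comp (by fun_prop)
    rw [ContinuousLinearMap.intervalIntegral_apply (hc.intervalIntegrable _ _)]
    have hder : ∀ t ∈ Set.uIcc (0 : ℝ) 1, HasDerivAt (fun t : ℝ => f (s, v + t • (u - v)))
        (G ((s, u, v), t) (u - v)) t := by
      intro t _
      have h1 : ContDiff ℝ ∞ (fun e => f (s, e)) := hf.comp (by fun_prop)
      have h2 := (h1.differentiable (by simp) (v + t • (u - v))).hasFDerivAt
      have h3 : HasDerivAt (fun t : ℝ => v + t • (u - v)) (u - v) t := by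
        simpa using ((hasDerivAt_id t).smul_const (u - v)).const_add v
      exact h2.comp_hasDerivAt t h3
    rw [intervalIntegral.integral_eq_sub_of_hasDerivAt hder
      ((hc.clm_apply continuous_const).intervalIntegrable _ _)]
    simp
  · simp [hG]

end ParametricIntegral

/-! ### Local parametrisations -/

section LocalParam

variable {E : Type*} [NormedAddCommGroup E] [NormedSpace ℝ E]
  {N : Type*} [TopologicalSpace N] [ChartedSpace E N]

/-- A globally defined smooth map `E → N` that is the inverse of the preferred chart at `p` near
the coordinates of `p`. -/
structure IsLocalParam (p : N) (ψ : E → N) : Prop where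
  contMDiff : ContMDiff 𝓘(ℝ, E) 𝓘(ℝ, E) ∞ ψ
  eventuallyEq : ψ =ᶠ[𝓝 (chartAt E p p)] (chartAt E p).symm

theorem IsLocalParam.apply_chart {p : N} {ψ : E → N} (h : IsLocalParam p ψ) :
    ψ (chartAt E p p) = p :=
  h.eventuallyEq.self_of_nhds.trans ((chartAt E p).left_inv (mem_chart_source E p))

theorem IsLocalParam.eventually_apply_chart {p : N} {ψ : E → N} (h : IsLocalParam p ψ) :
    ∀ᶠ q in 𝓝 p, ψ (chartAt E p q) = q := by
  have h1 := ((chartAt E p).continuousAt (mem_chart_source E p)).eventually h.eventuallyEq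
  filter_upwards [h1, (chartAt E p).open_source.mem_nhds (mem_chart_source E p)] with q hq hq'
  rw [hq, (chartAt E p).left_inv hq']

theorem IsLocalParam.eventually_chart_apply {p : N} {ψ : E → N} (h : IsLocalParam p ψ) :
    ∀ᶠ e in 𝓝 (chartAt E p p), chartAt E p (ψ e) = e := by
  filter_upwards [h.eventuallyEq,
    (chartAt E p).open_target.mem_nhds (mem_chart_target E p)] with e he he'
  rw [he, (chartAt E p).right_inv he']

/-- Because `ψ` is defined on all of `E`, smoothness can be tested by ordinary `ContDiff` without
tracking domains. Because its image lies in `U`, a property valid near `p` holds at every parameter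
after pulling back along `ψ`. -/
theorem exists_isLocalParam [FiniteDimensional ℝ E] [IsManifold 𝓘(ℝ, E) ∞ N] (p : N) {U : Set N}
    (hU : U ∈ 𝓝 p) : ∃ ψ : E → N, IsLocalParam p ψ ∧ ∀ e, ψ e ∈ U := by
  set φ := chartAt E p with hφ
  have hp : p ∈ φ.source := mem_chart_source E p
  have hV : φ.target ∩ φ.symm ⁻¹' U ∈ 𝓝 (φ p) := by
    refine inter_mem (φ.open_target.mem_nhds (φ.map_source hp)) ?_
    have := φ.continuousAt_symm (φ.map_source hp)
    refine this.preimage_mem_nhds ?_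
    rwa [φ.left_inv hp]
  obtain ⟨r, hr, hrV⟩ := Metric.mem_nhds_iff.1 hV
  let b : ContDiffBump (φ p) := ⟨r / 4, r / 2, by positivity, by linarith⟩
  -- The displacement from `φ p` is damped by a bump function: `θ` is the identity near `φ p` and
  -- never leaves the ball of radius `r`.
  let θ : E → E := fun e => φ p + b e • (e - φ p)
  have hθs : ContDiff ℝ ∞ θ :=
    contDiff_const.add (b.contDiff.smul (contDiff_id.sub contDiff_const))
  have hθ : ∀ e, θ e ∈ Metric.ball (φ p) r := by
    intro e
    simp only [θ, Metric.mem_ball, dist_self_add_left, norm_smul, Real.norm_eq_abs,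
      abs_of_nonneg (b.nonneg)]
    by_cases he : dist e (φ p) < r / 2
    · rw [dist_eq_norm] at he
      calc b e * ‖e - φ p‖ ≤ 1 * ‖e - φ p‖ := by gcongr; exact b.le_one
        _ < r := by linarith
    · rw [b.zero_of_le_dist (not_lt.1 he)]
      simpa using hr
  refine ⟨φ.symm ∘ θ, ⟨?_, ?_⟩, fun e => (hrV (hθ e)).2⟩
  · exact (contMDiffOn_chart_symm (I := 𝓘(ℝ, E)) (x := p)).comp_contMDiff hθs.contMDiff
      fun e => (hrV (hθ e)).1
  · filter_upwards [b.eventuallyEq_one] with e he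
    simp [θ, he, hφ]

end LocalParam

/-! ### Smooth families in local parametrisations -/

section Families

variable {F : Type*} [NormedAddCommGroup F] [NormedSpace ℝ F]
  {T : Type*} [TopologicalSpace T] [ChartedSpace F T] [IsManifold 𝓘(ℝ, F) ∞ T]
  {E : Type*} [NormedAddCommGroup E] [NormedSpace ℝ E]
  {M : Type*} [TopologicalSpace M] [ChartedSpace E M] [IsManifold 𝓘(ℝ, E) ∞ M]

theorem IsSmoothFamily.contDiff_comp {S : Type*} [NormedAddCommGroup S] [NormedSpace ℝ S]
    {f : T → SmoothFun E M} (hf : IsSmoothFamily F f)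
    {ψ : S → T} (hψ : ContMDiff 𝓘(ℝ, S) 𝓘(ℝ, F) ∞ ψ) {χ : S → M}
    (hχ : ContMDiff 𝓘(ℝ, S) 𝓘(ℝ, E) ∞ χ) :
    ContDiff ℝ ∞ (fun s => (f (ψ s) : M → ℂ) (χ s)) :=
  contMDiff_iff_contDiff.1 (ContMDiff.comp hf (hψ.prodMk hχ))

theorem IsSmoothFamily.comp {F' : Type*} [NormedAddCommGroup F'] [NormedSpace ℝ F']
    {T' : Type*} [TopologicalSpace T'] [ChartedSpace F' T']
    {f : T → SmoothFun E M} (hf : IsSmoothFamily F f)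
    {ψ : T' → T} (hψ : ContMDiff 𝓘(ℝ, F') 𝓘(ℝ, F) ∞ ψ) :
    IsSmoothFamily F' (fun s => f (ψ s)) :=
  ContMDiff.comp hf ((hψ.comp contMDiff_fst).prodMk contMDiff_snd)

theorem contMDiffAt_of_isLocalParam {h : T × M → ℂ} {σ₀ : T} {x₀ : M} {ψ : F → T} {χ : E → M}
    (hψ : IsLocalParam σ₀ ψ) (hχ : IsLocalParam x₀ χ)
    (hh : ContDiffAt ℝ ∞ (fun p : F × E => h (ψ p.1, χ p.2))
      (chartAt F σ₀ σ₀, chartAt E x₀ x₀)) :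
    ContMDiffAt (𝓘(ℝ, F).prod 𝓘(ℝ, E)) 𝓘(ℝ, ℂ) ∞ h (σ₀, x₀) := by
  have h1 : ContMDiffAt (𝓘(ℝ, F).prod 𝓘(ℝ, E)) 𝓘(ℝ, F × E) ∞
      (fun p : T × M => (chartAt F σ₀ p.1, chartAt E x₀ p.2)) (σ₀, x₀) := by
    refine ContMDiffAt.prodMk_space ?_ ?_
    · exact (contMDiffAt_of_mem_maximalAtlas (IsManifold.chart_mem_maximalAtlas (I := 𝓘(ℝ, F)) σ₀)
        (mem_chart_source F σ₀)).comp (σ₀, x₀) contMDiffAt_fst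
    · exact (contMDiffAt_of_mem_maximalAtlas (IsManifold.chart_mem_maximalAtlas (I := 𝓘(ℝ, E)) x₀)
        (mem_chart_source E x₀)).comp (σ₀, x₀) contMDiffAt_snd
  refine (ContMDiffAt.comp (σ₀, x₀) hh.contMDiffAt h1).congr_of_eventuallyEq ?_
  have e1 := hψ.eventually_apply_chart
  have e2 := hχ.eventually_apply_chart
  filter_upwards [e1.prod_nhds e2] with p hp
  simp [hp.1, hp.2]

theorem isSmoothFamily_of_isLocalParam {f : T → SmoothFun E M}
    (h : ∀ (σ₀ : T) (x₀ : M), ∃ (ψ : F → T) (χ : E → M), IsLocalParam σ₀ ψ ∧ IsLocalParam x₀ χ ∧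
      ContDiffAt ℝ ∞ (fun p : F × E => (f (ψ p.1) : M → ℂ) (χ p.2))
        (chartAt F σ₀ σ₀, chartAt E x₀ x₀)) :
    IsSmoothFamily F f := by
  rintro ⟨σ₀, x₀⟩
  obtain ⟨ψ, χ, hψ, hχ, hh⟩ := h σ₀ x₀
  exact contMDiffAt_of_isLocalParam hψ hχ hh

theorem isLocalParam_id {S : Type*} [NormedAddCommGroup S] [NormedSpace ℝ S] (s : S) :
    IsLocalParam s (id : S → S) := ⟨contMDiff_id, EventuallyEq.rfl⟩

/-- A smooth family that is constant in the parameter. -/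
theorem isSmoothFamily_const (g : SmoothFun E M) : IsSmoothFamily F (fun _ : T => g) :=
  ContMDiff.comp (g := (g : M → ℂ)) g.2 contMDiff_snd

theorem IsSmoothFamily.mul {f g : T → SmoothFun E M} (hf : IsSmoothFamily F f)
    (hg : IsSmoothFamily F g) : IsSmoothFamily F (fun σ => f σ * g σ) :=
  (contDiff_mul (𝕜 := ℝ) (𝔸 := ℂ)).contMDiff.comp (ContMDiff.prodMk_space hf hg)

theorem IsSmoothFamily.neg {f : T → SmoothFun E M} (hf : IsSmoothFamily F f) :
    IsSmoothFamily F (fun σ => -f σ) := ContMDiff.neg hf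

theorem IsSmoothFamily.sub {f g : T → SmoothFun E M} (hf : IsSmoothFamily F f)
    (hg : IsSmoothFamily F g) : IsSmoothFamily F (fun σ => f σ - g σ) := ContMDiff.sub hf hg

end Families

/-! ### The algebra of differential operators -/

section DiffOp

variable {E : Type*} [NormedAddCommGroup E] [NormedSpace ℝ E]
  {M : Type*} [TopologicalSpace M] [ChartedSpace E M]

/-- The commutator of an operator with multiplication by a function. -/
def commMul (P : Module.End ℂ (SmoothFun E M)) (g : SmoothFun E M) :
    Module.End ℂ (SmoothFun E M) :=
  P * LinearMap.mulLeft ℂ g - LinearMap.mulLeft ℂ g * P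

theorem commMul_apply (P : Module.End ℂ (SmoothFun E M)) (g f : SmoothFun E M) :
    commMul P g f = P (g * f) - g * P f := rfl

theorem commMul_zero (g : SmoothFun E M) : commMul 0 g = 0 :=
  LinearMap.ext fun f => show (0 : SmoothFun E M) - g * 0 = 0 by rw [mul_zero, sub_zero]

theorem commMul_one (g : SmoothFun E M) : commMul 1 g = 0 :=
  LinearMap.ext fun f => show g * f - g * f = 0 from sub_self _

theorem commMul_add (P Q : Module.End ℂ (SmoothFun E M)) (g : SmoothFun E M) :
    commMul (P + Q) g = commMul P g + commMul Q g :=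
  LinearMap.ext fun f => show P (g * f) + Q (g * f) - g * (P f + Q f) =
    P (g * f) - g * P f + (Q (g * f) - g * Q f) by ring

theorem commMul_neg (P : Module.End ℂ (SmoothFun E M)) (g : SmoothFun E M) :
    commMul (-P) g = -commMul P g :=
  LinearMap.ext fun f => show -P (g * f) - g * -P f = -(P (g * f) - g * P f) by ring

theorem commMul_sub (P Q : Module.End ℂ (SmoothFun E M)) (g : SmoothFun E M) :
    commMul (P - Q) g = commMul P g - commMul Q g :=
  LinearMap.ext fun f => show P (g * f) - Q (g * f) - g * (P f - Q f) =
    P (g * f) - g * P f - (Q (g * f) - g * Q f) by ring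

theorem commMul_mul (P Q : Module.End ℂ (SmoothFun E M)) (g : SmoothFun E M) :
    commMul (P * Q) g = P * commMul Q g + commMul P g * Q :=
  LinearMap.ext fun f => show P (Q (g * f)) - g * P (Q f) =
    P (Q (g * f) - g * Q f) + (P (g * Q f) - g * P (Q f)) by rw [map_sub]; ring

/-- Differential operators of order less than `n`. -/
def IsDiffOpLT : ℕ → Module.End ℂ (SmoothFun E M) → Prop
  | 0, P => P = 0
  | n + 1, P => ∀ g : SmoothFun E M, IsDiffOpLT n (commMul P g)

/-- The strict bound shifts the index by one, so that inductions on the order can start from the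
zero operator. -/
theorem isDiffOpLT_succ_iff {n : ℕ} {P : Module.End ℂ (SmoothFun E M)} :
    IsDiffOpLT (n + 1) P ↔ IsDiffOp n P := by
  induction n generalizing P with
  | zero => rfl
  | succ n ih => exact forall_congr' fun g => ih

theorem isDiffOpLT_zero (n : ℕ) : IsDiffOpLT n (0 : Module.End ℂ (SmoothFun E M)) := by
  induction n with
  | zero => rfl
  | succ n ih => intro g; rwa [commMul_zero]

theorem IsDiffOpLT.succ {n : ℕ} {P : Module.End ℂ (SmoothFun E M)} (h : IsDiffOpLT n P) :
    IsDiffOpLT (n + 1) P := by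
  induction n generalizing P with
  | zero => rw [show P = 0 from h]; exact isDiffOpLT_zero _
  | succ n ih => exact fun g => ih (h g)

theorem IsDiffOpLT.mono {m n : ℕ} {P : Module.End ℂ (SmoothFun E M)} (h : IsDiffOpLT m P)
    (hmn : m ≤ n) : IsDiffOpLT n P := by
  induction n, hmn using Nat.le_induction with
  | base => exact h
  | succ n _ ih => exact ih.succ

theorem IsDiffOpLT.add {n : ℕ} {P Q : Module.End ℂ (SmoothFun E M)} (hP : IsDiffOpLT n P)
    (hQ : IsDiffOpLT n Q) : IsDiffOpLT n (P + Q) := by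
  induction n generalizing P Q with
  | zero => rw [show P = 0 from hP, show Q = 0 from hQ]; exact add_zero 0
  | succ n ih => intro g; rw [commMul_add]; exact ih (hP g) (hQ g)

theorem IsDiffOpLT.neg {n : ℕ} {P : Module.End ℂ (SmoothFun E M)} (hP : IsDiffOpLT n P) :
    IsDiffOpLT n (-P) := by
  induction n generalizing P with
  | zero => rw [show P = 0 from hP]; exact LinearMap.ext fun f => neg_zero
  | succ n ih => intro g; rw [commMul_neg]; exact ih (hP g)

/-- Double induction through the Leibniz rule `[PQ, g] = P [Q, g] + [P, g] Q`: each summand lowers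
the order of one factor. The bound is not sharp, but only some finite bound is ever needed. -/
theorem IsDiffOpLT.mul {m n : ℕ} {P Q : Module.End ℂ (SmoothFun E M)} (hP : IsDiffOpLT m P)
    (hQ : IsDiffOpLT n Q) : IsDiffOpLT (m + n) (P * Q) := by
  induction m generalizing n P Q with
  | zero => rw [show P = 0 from hP, zero_mul]; exact isDiffOpLT_zero _
  | succ m ihm =>
    induction n generalizing Q with
    | zero => rw [show Q = 0 from hQ, mul_zero]; exact isDiffOpLT_zero _
    | succ n ihn =>
      intro g
      rw [commMul_mul]
      refine IsDiffOpLT.add (ihn (hQ g)) ?_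
      exact (ihm (hP g) hQ).mono (show m + (n + 1) ≤ (m + 1).add n from (Nat.succ_add m n).ge)

theorem isDiffOpLT_one : IsDiffOpLT 1 (1 : Module.End ℂ (SmoothFun E M)) := by
  exact commMul_one

/-- Evaluation at a zero of the function multiplied with. -/
theorem apply_sub_const_mul (P : Module.End ℂ (SmoothFun E M)) (u k : SmoothFun E M) (y : M) :
    (P ((u - algebraMap ℂ _ ((u : M → ℂ) y)) * k) : M → ℂ) y = (commMul P u k : M → ℂ) y := by
  rw [commMul_apply, sub_mul, map_sub, ← Algebra.smul_def, map_smul]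
  rfl

end DiffOp

/-! ### Differential operators act smoothly on smooth families -/

section SmoothAction

variable {E : Type} [NormedAddCommGroup E] [NormedSpace ℝ E] [FiniteDimensional ℝ E]
  {M : Type*} [TopologicalSpace M] [T2Space M] [ChartedSpace E M] [IsManifold 𝓘(ℝ, E) ∞ M]

/-- Outside its domain the chart has arbitrary values, but there the bump function vanishes on a
neighbourhood. -/
theorem contMDiff_bump_smul {S : Type*} [NormedAddCommGroup S] [NormedSpace ℝ S] {x₀ : M}
    (χ : SmoothBumpFunction 𝓘(ℝ, E) x₀) {h : S × E → ℂ} (hh : ContDiff ℝ ∞ h) :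
    ContMDiff (𝓘(ℝ, S).prod 𝓘(ℝ, E)) 𝓘(ℝ, ℂ) ∞
      (fun p : S × M => ((χ p.2 : ℝ) : ℂ) * h (p.1, chartAt E x₀ p.2)) := by
  rintro ⟨s, x⟩
  by_cases hx : x ∈ (chartAt E x₀).source
  · have h1 : ContMDiffAt (𝓘(ℝ, S).prod 𝓘(ℝ, E)) 𝓘(ℝ, S × E) ∞
        (fun p : S × M => (p.1, chartAt E x₀ p.2)) (s, x) :=
      contMDiffAt_fst.prodMk_space ((contMDiffAt_of_mem_maximalAtlas
        (IsManifold.chart_mem_maximalAtlas (I := 𝓘(ℝ, E)) x₀) hx).comp (s, x) contMDiffAt_snd)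
    have h2 : ContMDiffAt (𝓘(ℝ, S).prod 𝓘(ℝ, E)) 𝓘(ℝ, ℂ) ∞
        (fun p : S × M => ((χ p.2 : ℝ) : ℂ)) (s, x) :=
      Complex.ofRealCLM.contDiff.contMDiff.contMDiffAt.comp (s, x)
        (χ.contMDiff.contMDiffAt.comp (s, x) contMDiffAt_snd)
    exact (contDiff_mul (𝕜 := ℝ) (𝔸 := ℂ)).contMDiff.contMDiffAt.comp (s, x)
      (h2.prodMk_space (hh.contMDiff.contMDiffAt.comp (s, x) h1))
  · have hx' : x ∉ tsupport χ := fun h => hx (χ.tsupport_subset_chartAt_source h)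
    have h0 := notMem_tsupport_iff_eventuallyEq.1 hx'
    refine (contMDiffAt_const (c := (0 : ℂ))).congr_of_eventuallyEq ?_
    have := (continuous_snd (X := S) (Y := M)).continuousAt (x := (s, x)) |>.eventually h0
    filter_upwards [this] with p hp
    simp [hp]

/-- Hadamard's lemma on a manifold, with parameters: near `x₀`, a smooth family `f` can be written
as `f_s(x) = f_s(y) + ∑ (u_i(x) - u_i(y)) k_i(x)` with globally defined functions
`u_i` and smooth families `k_i` depending on `s` and the coordinates of `y`. -/
theorem exists_hadamard_family {S : Type*} [NormedAddCommGroup S] [NormedSpace ℝ S]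
    [FiniteDimensional ℝ S] {f : S → SmoothFun E M} (hf : IsSmoothFamily S f) (x₀ : M) :
    ∃ (ψ : E → M) (m : ℕ) (u : Fin m → SmoothFun E M) (k : Fin m → S × E → SmoothFun E M),
      IsLocalParam x₀ ψ ∧ (∀ i, IsSmoothFamily (S × E) (k i)) ∧
      ∀ᶠ e in 𝓝 (chartAt E x₀ x₀), ∀ s, f s = algebraMap ℂ _ ((f s : M → ℂ) (ψ e)) +
        ∑ i, (u i - algebraMap ℂ _ ((u i : M → ℂ) (ψ e))) * k i (s, e) := by
  obtain ⟨ψ, hψ, -⟩ := exists_isLocalParam (E := E) x₀ (univ_mem (f := 𝓝 x₀))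
  set φ := chartAt E x₀ with hφ
  have hψ' := hψ.eventually_apply_chart
  obtain ⟨χ, -, hχ⟩ := ((SmoothBumpFunction.nhds_basis_support (I := 𝓘(ℝ, E)) hψ').mem_iff).1 hψ'
  have hF : ContDiff ℝ ∞ (fun p : S × E => (f p.1 : M → ℂ) (ψ p.2)) :=
    hf.contDiff_comp (T := S) (S := S × E) (contDiff_fst.contMDiff)
      (hψ.contMDiff.comp contDiff_snd.contMDiff)
  obtain ⟨H, hH, hHd, -⟩ := exists_hadamard hF
  let b := Module.finBasis ℝ E
  let d := Module.finrank ℝ E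
  have hb : ∀ i, ContDiff ℝ ∞ (fun e : E => b.repr e i) := fun i =>
    (LinearMap.toContinuousLinearMap (b.coord i)).contDiff
  have hχs : ContMDiff 𝓘(ℝ, E) 𝓘(ℝ, ℂ) ∞ (fun x => ((χ x : ℝ) : ℂ)) :=
    Complex.ofRealCLM.contDiff.contMDiff.comp χ.contMDiff
  -- Coordinates are cut off to become global functions. Where `χ (ψ e) = 1`, the value of `c i` at
  -- `ψ e` is still the coordinate `e_i`.
  let c : Fin d → SmoothFun E M := fun i => ⟨fun x => ((χ x : ℝ) : ℂ) * (b.repr (φ x) i : ℝ), by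
    have := contMDiff_bump_smul (S := ℝ) χ (h := fun p => ((b.repr p.2 i : ℝ) : ℂ))
      (Complex.ofRealCLM.contDiff.comp ((hb i).comp contDiff_snd))
    exact this.comp ((contMDiff_const (c := (0 : ℝ))).prodMk contMDiff_id)⟩
  let a : SmoothFun E M := ⟨fun x => ((χ x : ℝ) : ℂ), hχs⟩
  have hl : ∀ i, ContMDiff (𝓘(ℝ, S × E).prod 𝓘(ℝ, E)) 𝓘(ℝ, ℂ) ∞ (fun p : (S × E) × M =>
      ((χ p.2 : ℝ) : ℂ) * H (p.1.1, φ p.2, p.1.2) (b i)) := fun i =>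
    contMDiff_bump_smul (S := S × E) χ (h := fun p => H (p.1.1, p.2, p.1.2) (b i))
      ((hH.comp (by fun_prop)).clm_apply contDiff_const)
  let l : Fin d → S × E → SmoothFun E M := fun i q => ⟨fun x =>
    ((χ x : ℝ) : ℂ) * H (q.1, φ x, q.2) (b i),
    (hl i).comp ((contMDiff_const (c := q)).prodMk contMDiff_id)⟩
  have hls : ∀ i, IsSmoothFamily (S × E) (l i) := hl
  -- This factor repairs the cutoff. With `δ = f - f(y)` and `χ δ = ∑ (φ_i - e_i) l_i`, the cut-off
  -- coordinates contribute `∑ (χ φ_i - e_i) l_i = χ² δ - (1 - χ) ∑ e_i l_i`. What is missing from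
  -- `δ` is `(1 - χ) ((1 + χ) δ + ∑ e_i l_i)`, which is `1 - χ` times `l0`; and `1 - χ` vanishes at
  -- `y`.
  let l0 : S × E → SmoothFun E M := fun q =>
    (1 + a) * (f q.1 - algebraMap ℂ _ ((f q.1 : M → ℂ) (ψ q.2))) +
      ∑ i, algebraMap ℂ _ ((b.repr q.2 i : ℝ) : ℂ) * l i q
  have halg : ∀ {g : S × E → ℂ}, ContDiff ℝ ∞ g →
      IsSmoothFamily (S × E) (fun q => algebraMap ℂ (SmoothFun E M) (g q)) := fun hg =>
    hg.contMDiff.comp contMDiff_fst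
  have hl0 : IsSmoothFamily (S × E) l0 := by
    refine isSmoothFamily_add ?_ (isSmoothFamily_sum _ fun i _ => ?_)
    · exact (isSmoothFamily_const _).mul
        ((hf.comp contDiff_fst.contMDiff).sub (halg hF))
    · exact (halg (Complex.ofRealCLM.contDiff.comp ((hb i).comp contDiff_snd))).mul (hls i)
  refine ⟨ψ, d + 1, Fin.cons (1 - a) c, Fin.cons l0 l, hψ, fun i => ?_, ?_⟩
  · refine Fin.cases ?_ (fun i => ?_) i
    · exact hl0
    · exact hls i
  have h1 : ∀ᶠ e in 𝓝 (φ x₀), χ (ψ e) = 1 :=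
    (hψ.contMDiff.continuous.continuousAt (x := φ x₀)).eventually
      (by rw [hψ.apply_chart]; exact χ.eventuallyEq_one)
  filter_upwards [h1, hψ.eventually_chart_apply] with e he he' s
  ext x
  simp only [Fin.sum_univ_succ, Fin.cons_zero, Fin.cons_succ]
  have hsum : ∀ (g : Fin d → SmoothFun E M), ((∑ i, g i : SmoothFun E M) : M → ℂ) x =
      ∑ i, (g i : M → ℂ) x := fun g => by
    rw [AddSubmonoidClass.coe_finsetSum, Finset.sum_apply]
  have hl0x : (l0 (s, e) : M → ℂ) x = (1 + ((χ x : ℝ) : ℂ)) * ((f s : M → ℂ) x - (f s : M → ℂ) (ψ e))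
      + ∑ i, ((b.repr e i : ℝ) : ℂ) * (l i (s, e) : M → ℂ) x := by
    rw [← show _ = ∑ i, ((b.repr e i : ℝ) : ℂ) * (l i (s, e) : M → ℂ) x from
      hsum fun i => algebraMap ℂ _ ((b.repr e i : ℝ) : ℂ) * l i (s, e)]
    rfl
  have hcx : ∀ i, (((c i - algebraMap ℂ _ ((c i : M → ℂ) (ψ e))) * l i (s, e) : SmoothFun E M) : M → ℂ) x
      = (((χ x : ℝ) : ℂ) * (b.repr (φ x) i : ℝ) - (b.repr e i : ℝ)) * (l i (s, e) : M → ℂ) x := by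
    intro i
    have : (c i : M → ℂ) (ψ e) = (b.repr e i : ℝ) := by
      change ((χ (ψ e) : ℝ) : ℂ) * (b.repr (φ (ψ e)) i : ℝ) = _
      rw [he, he']; simp
    rw [this]; rfl
  have key : ((χ x : ℝ) : ℂ) * ((f s : M → ℂ) x - (f s : M → ℂ) (ψ e)) =
      ∑ i, (((b.repr (φ x) i : ℝ) : ℂ) - (b.repr e i : ℝ)) * (l i (s, e) : M → ℂ) x := by
    by_cases hx : χ x = 0
    · have : ∀ i, (l i (s, e) : M → ℂ) x = 0 := fun i => by
        change ((χ x : ℝ) : ℂ) * _ = 0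
        simp [hx]
      simp [hx, this]
    · have h2 : ψ (φ x) = x := hχ hx
      have h3 := hHd s (φ x) e
      simp only [h2] at h3
      rw [h3, ← b.sum_repr (φ x - e), map_sum, Finset.mul_sum]
      refine Finset.sum_congr rfl fun i _ => ?_
      rw [map_smul]
      change _ = _ * (((χ x : ℝ) : ℂ) * H (s, φ x, e) (b i))
      simp only [map_sub, Finsupp.coe_sub, Pi.sub_apply, Complex.real_smul]
      push_cast
      ring
  have hax : ((((1 - a) - algebraMap ℂ _ (((1 - a : SmoothFun E M) : M → ℂ) (ψ e))) * l0 (s, e) :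
      SmoothFun E M) : M → ℂ) x = (1 - ((χ x : ℝ) : ℂ)) * (l0 (s, e) : M → ℂ) x := by
    have : ((1 - a : SmoothFun E M) : M → ℂ) (ψ e) = 0 := by
      change 1 - ((χ (ψ e) : ℝ) : ℂ) = 0
      rw [he]; simp
    rw [this]
    change (1 - ((χ x : ℝ) : ℂ) - 0) * _ = _
    rw [sub_zero]
  change (f s : M → ℂ) x = (f s : M → ℂ) (ψ e) + (_ + ((∑ i, (c i - algebraMap ℂ _
    ((c i : M → ℂ) (ψ e))) * l i (s, e) : SmoothFun E M) : M → ℂ) x)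
  rw [hsum]
  simp only [hcx]
  erw [hax]
  rw [hl0x]
  have e1 : ∑ i, (((χ x : ℝ) : ℂ) * (b.repr (φ x) i : ℝ) - (b.repr e i : ℝ)) * (l i (s, e) : M → ℂ) x
     = ((χ x : ℝ) : ℂ) * (∑ i, (((b.repr (φ x) i : ℝ) : ℂ) - (b.repr e i : ℝ)) * (l i (s, e) : M → ℂ) x)
      - (1 - ((χ x : ℝ) : ℂ)) * ∑ i, ((b.repr e i : ℝ) : ℂ) * (l i (s, e) : M → ℂ) x := by
    rw [Finset.mul_sum, Finset.mul_sum, ← Finset.sum_sub_distrib]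
    exact Finset.sum_congr rfl fun i _ => by ring
  rw [e1, ← key]
  ring

/-- Hadamard's expansion of `f_s` around `y` gives `Q_s(f_s)(y) = f_s(y) Q_s(1)(y) + ∑ [Q_s,
u_i](k_i)(y)`, and the commutators have lower order. The functions `k_i` depend on `y` as well, so
the induction passes from the parameter space `S` to `S × E`; taking `E` in `Type` keeps this
product in the universe of `S`. -/
theorem IsDiffOpLT.isSmoothFamily_apply (n : ℕ) {S : Type*} [NormedAddCommGroup S]
    [NormedSpace ℝ S] [FiniteDimensional ℝ S] {Q : S → Module.End ℂ (SmoothFun E M)}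
    (hQ : ∀ s, IsDiffOpLT n (Q s)) (hQs : ∀ g, IsSmoothFamily S (fun s => Q s g))
    {f : S → SmoothFun E M} (hf : IsSmoothFamily S f) :
    IsSmoothFamily S (fun s => Q s (f s)) := by
  induction n generalizing S with
  | zero =>
    have : (fun s => Q s (f s)) = fun _ => 0 := by
      ext1 s; rw [show Q s = 0 from hQ s]; rfl
    rw [this]
    exact isSmoothFamily_const 0
  | succ n ih =>
    refine isSmoothFamily_of_isLocalParam fun s₀ x₀ => ?_
    obtain ⟨ψ, m, u, k, hψ, hk, hfe⟩ := exists_hadamard_family hf x₀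
    refine ⟨id, ψ, isLocalParam_id s₀, hψ, ?_⟩
    have hψ2 : ContMDiff 𝓘(ℝ, S × E) 𝓘(ℝ, E) ∞ (fun p : S × E => ψ p.2) :=
      hψ.contMDiff.comp contDiff_snd.contMDiff
    have hfst : ContMDiff 𝓘(ℝ, S × E) 𝓘(ℝ, S) ∞ (Prod.fst : S × E → S) := contDiff_fst.contMDiff
    have hA : ContDiff ℝ ∞ (fun p : S × E =>
        (f p.1 : M → ℂ) (ψ p.2) * (Q p.1 1 : M → ℂ) (ψ p.2)) :=
      (hf.contDiff_comp hfst hψ2).mul ((hQs 1).contDiff_comp hfst hψ2)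
    have hB : ∀ i, ContDiff ℝ ∞ (fun p : S × E =>
        (commMul (Q p.1) (u i) (k i p) : M → ℂ) (ψ p.2)) := by
      intro i
      have := ih (S := S × E) (Q := fun p => commMul (Q p.1) (u i)) (fun p => hQ p.1 (u i))
        (fun g => ?_) (hk i)
      · exact this.contDiff_comp contMDiff_id hψ2
      · exact ((hQs (u i * g)).sub ((isSmoothFamily_const _).mul (hQs g))).comp hfst
    refine ((hA.add (ContDiff.sum (s := Finset.univ) fun i _ => hB i)).contDiffAt).congr_of_eventuallyEq ?_
    have hfe' : ∀ᶠ p : S × E in 𝓝 (chartAt S s₀ s₀, chartAt E x₀ x₀), ∀ s,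
        f s = algebraMap ℂ _ ((f s : M → ℂ) (ψ p.2)) +
        ∑ i, (u i - algebraMap ℂ _ ((u i : M → ℂ) (ψ p.2))) * k i (s, p.2) :=
      hfe.prod_inr_nhds _
    filter_upwards [hfe'] with p hp
    change (Q p.1 (f p.1) : M → ℂ) (ψ p.2) = _
    conv_lhs => rw [hp p.1]
    rw [map_add, map_sum, Algebra.algebraMap_eq_smul_one, map_smul]
    have hsum : ∀ (g : Fin m → SmoothFun E M) (x : M), ((∑ i, g i : SmoothFun E M) : M → ℂ) x =
        ∑ i, (g i : M → ℂ) x := fun g x => by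
      rw [AddSubmonoidClass.coe_finsetSum, Finset.sum_apply]
    change _ * _ + (((∑ i, _ : SmoothFun E M) : M → ℂ) (ψ p.2)) = _
    rw [hsum]
    simp only [apply_sub_const_mul]

end SmoothAction

/-! ### Smooth families of differential operators -/

section OpFamily

variable {F : Type*} [NormedAddCommGroup F] [NormedSpace ℝ F]
  {T : Type*} [TopologicalSpace T] [ChartedSpace F T]
  {E : Type*} [NormedAddCommGroup E] [NormedSpace ℝ E]
  {M : Type*} [TopologicalSpace M] [ChartedSpace E M]

variable (F) in
/-- Families of differential operators of locally bounded order that are smooth on every fixed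
function. -/
structure IsSmoothOpFamily (Q : T → Module.End ℂ (SmoothFun E M)) : Prop where
  order : ∀ σ₀ : T, ∃ N : ℕ, ∀ᶠ σ in 𝓝 σ₀, IsDiffOpLT N (Q σ)
  smooth_const : ∀ g, IsSmoothFamily F (fun σ => Q σ g)

theorem IsSmoothOpFamily.const {P : Module.End ℂ (SmoothFun E M)} {N : ℕ} (hP : IsDiffOpLT N P) :
    IsSmoothOpFamily F (fun _ : T => P) :=
  ⟨fun _ => ⟨N, Eventually.of_forall fun _ => hP⟩, fun g => ContMDiff.comp (g := (P g : M → ℂ))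
    (P g).2 contMDiff_snd⟩

theorem IsSmoothOpFamily.add {P Q : T → Module.End ℂ (SmoothFun E M)} (hP : IsSmoothOpFamily F P)
    (hQ : IsSmoothOpFamily F Q) : IsSmoothOpFamily F (fun σ => P σ + Q σ) := by
  refine ⟨fun σ₀ => ?_, fun g => isSmoothFamily_add (hP.smooth_const g) (hQ.smooth_const g)⟩
  obtain ⟨m, hm⟩ := hP.order σ₀
  obtain ⟨n, hn⟩ := hQ.order σ₀
  refine ⟨max m n, ?_⟩
  filter_upwards [hm, hn] with σ h1 h2
  exact (h1.mono (le_max_left _ _)).add (h2.mono (le_max_right _ _))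

theorem IsSmoothOpFamily.neg {P : T → Module.End ℂ (SmoothFun E M)} (hP : IsSmoothOpFamily F P) :
    IsSmoothOpFamily F (fun σ => -P σ) := by
  refine ⟨fun σ₀ => ?_, fun g => ContMDiff.neg (hP.smooth_const g)⟩
  obtain ⟨m, hm⟩ := hP.order σ₀
  exact ⟨m, hm.mono fun σ h => h.neg⟩

theorem IsSmoothOpFamily.sum {α : Type*} (s : Finset α) {P : α → T → Module.End ℂ (SmoothFun E M)}
    (hP : ∀ a ∈ s, IsSmoothOpFamily F (P a)) : IsSmoothOpFamily F (fun σ => ∑ a ∈ s, P a σ) := by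
  classical
  induction s using Finset.induction_on with
  | empty => simpa using IsSmoothOpFamily.const (isDiffOpLT_zero 0)
  | insert a s ha ih =>
    simp only [Finset.sum_insert ha]
    exact (hP a (by simp)).add (ih fun b hb => hP b (by simp [hb]))

end OpFamily

/-! ### Operator families acting on smooth families, and the product rule -/

section Action

variable {F : Type*} [NormedAddCommGroup F] [NormedSpace ℝ F] [FiniteDimensional ℝ F]
  {T : Type*} [TopologicalSpace T] [ChartedSpace F T] [IsManifold 𝓘(ℝ, F) ∞ T]
  {E : Type} [NormedAddCommGroup E] [NormedSpace ℝ E] [FiniteDimensional ℝ E]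
  {M : Type*} [TopologicalSpace M] [T2Space M] [ChartedSpace E M] [IsManifold 𝓘(ℝ, E) ∞ M]

/-- Near `σ₀` the order is bounded, and a parametrisation with values in that neighbourhood reduces
the claim to a vector space of parameters with one global bound. -/
theorem IsSmoothOpFamily.smooth {Q : T → Module.End ℂ (SmoothFun E M)}
    (hQ : IsSmoothOpFamily F Q) {f : T → SmoothFun E M} (hf : IsSmoothFamily F f) :
    IsSmoothFamily F (fun σ => Q σ (f σ)) := by
  refine isSmoothFamily_of_isLocalParam fun σ₀ x₀ => ?_
  obtain ⟨N, hN⟩ := hQ.order σ₀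
  obtain ⟨ψ, hψ, hψN⟩ := exists_isLocalParam (E := F) σ₀ hN
  obtain ⟨χ, hχ, -⟩ := exists_isLocalParam (E := E) x₀ (univ_mem (f := 𝓝 x₀))
  have h1 := IsDiffOpLT.isSmoothFamily_apply N hψN
    (fun g => (hQ.smooth_const g).comp hψ.contMDiff) (hf.comp hψ.contMDiff)
  exact ⟨ψ, χ, hψ, hχ, (h1.contDiff_comp (S := F × E) contDiff_fst.contMDiff
    (hχ.contMDiff.comp contDiff_snd.contMDiff)).contDiffAt⟩

theorem IsSmoothOpFamily.mul {P Q : T → Module.End ℂ (SmoothFun E M)} (hP : IsSmoothOpFamily F P)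
    (hQ : IsSmoothOpFamily F Q) : IsSmoothOpFamily F (fun σ => P σ * Q σ) := by
  refine ⟨fun σ₀ => ?_, fun g => hP.smooth (hQ.smooth_const g)⟩
  obtain ⟨m, hm⟩ := hP.order σ₀
  obtain ⟨n, hn⟩ := hQ.order σ₀
  refine ⟨m + n, ?_⟩
  filter_upwards [hm, hn] with σ h1 h2
  exact h1.mul h2

omit [T2Space M] in
/-- The divided difference of a curve of functions. -/
theorem exists_dividedDifference {f : ℝ → SmoothFun E M} (hf : IsSmoothFamily ℝ f) :
    ∃ w : ℝ → SmoothFun E M, IsSmoothFamily ℝ w ∧ (∀ t, f t = f 0 + (t : ℂ) • w t) ∧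
      ∀ x, (w 0 : M → ℂ) x = deriv (fun t => (f t : M → ℂ) x) 0 := by
  let w : ℝ → M → ℂ := fun t x => if t = 0 then deriv (fun t => (f t : M → ℂ) x) 0 else
    ((f t : M → ℂ) x - (f 0 : M → ℂ) x) / t
  have hw : ContMDiff (𝓘(ℝ, ℝ).prod 𝓘(ℝ, E)) 𝓘(ℝ, ℂ) ∞ (fun p : ℝ × M => w p.1 p.2) := by
    rintro ⟨t₀, x₀⟩
    obtain ⟨χ, hχ, -⟩ := exists_isLocalParam (E := E) x₀ (univ_mem (f := 𝓝 x₀))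
    refine contMDiffAt_of_isLocalParam (isLocalParam_id t₀) hχ ?_
    have hF : ContDiff ℝ ∞ (fun p : E × ℝ => (f p.2 : M → ℂ) (χ p.1)) :=
      hf.contDiff_comp (S := E × ℝ) contDiff_snd.contMDiff
        (hχ.contMDiff.comp contDiff_fst.contMDiff)
    obtain ⟨H, hH, hHd, hH0⟩ := exists_hadamard hF
    have e : (fun p : ℝ × E => w (id p.1) (χ p.2)) = fun p => H (p.2, p.1, 0) 1 := by
      ext ⟨t, e⟩
      simp only [id, w]
      split_ifs with ht
      · subst ht
        rw [hH0]; simp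
      · have h1 := hHd e t 0
        simp only [sub_zero] at h1
        rw [h1, show H (e, t, 0) t = H (e, t, 0) (t • (1 : ℝ)) by simp, map_smul,
          Complex.real_smul, mul_div_cancel_left₀ _ (by exact_mod_cast ht)]
    rw [e]
    exact ((hH.comp (by fun_prop)).clm_apply contDiff_const).contDiffAt
  refine ⟨fun t => ⟨w t, hw.comp (contMDiff_const.prodMk contMDiff_id)⟩, hw, fun t => ?_,
    fun x => by simp [w]⟩
  ext x
  change (f t : M → ℂ) x = (f 0 : M → ℂ) x + (t : ℂ) * w t x
  simp only [w]
  split_ifs with ht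
  · simp [ht]
  · rw [mul_div_cancel₀ _ (by exact_mod_cast ht)]; ring

omit [FiniteDimensional ℝ F] in
theorem IsLocalParam.exists_mfderiv_eq {σ : T} {ψ : F → T} (hψ : IsLocalParam σ ψ)
    (v : TangentSpace 𝓘(ℝ, F) σ) : ∃ w : F,
      ∀ h : T → ℂ, MDifferentiableAt 𝓘(ℝ, F) 𝓘(ℝ, ℂ) h σ →
        fderiv ℝ (h ∘ ψ) (chartAt F σ σ) w = mvfderiv 𝓘(ℝ, F) h σ v := by
  have hφ : MDifferentiableAt 𝓘(ℝ, F) 𝓘(ℝ, F) (chartAt F σ) σ :=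
    (contMDiffAt_of_mem_maximalAtlas (n := ∞) (IsManifold.chart_mem_maximalAtlas (I := 𝓘(ℝ, F)) σ)
        (mem_chart_source F σ)).mdifferentiableAt (by simp)
  refine ⟨mfderiv 𝓘(ℝ, F) 𝓘(ℝ, F) (chartAt F σ) σ v, fun h hh => ?_⟩
  have h1 : MDifferentiableAt 𝓘(ℝ, F) 𝓘(ℝ, ℂ) (h ∘ ψ) (chartAt F σ σ) := by
    refine MDifferentiableAt.comp (I' := 𝓘(ℝ, F)) _ ?_ (hψ.contMDiff.mdifferentiable (by simp) _)
    rwa [hψ.apply_chart]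
  have h2 : ((h ∘ ψ) ∘ chartAt F σ) =ᶠ[𝓝 σ] h := by
    filter_upwards [hψ.eventually_apply_chart] with q hq
    simp [hq]
  have h3 := mfderiv_comp_apply (I' := 𝓘(ℝ, F)) σ h1 hφ v
  rw [h2.mfderiv_eq, mfderiv_eq_fderiv] at h3
  exact h3.symm

/-- The curve is a line in the chart, pushed forward by a local parametrisation. Staying in `U` for
all times, it preserves a local bound on the order when an operator family is restricted to it. -/
theorem exists_curve (σ : T) (v : TangentSpace 𝓘(ℝ, F) σ) {U : Set T} (hU : U ∈ 𝓝 σ) :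
    ∃ γ : ℝ → T, ContMDiff 𝓘(ℝ, ℝ) 𝓘(ℝ, F) ∞ γ ∧ (∀ t, γ t ∈ U) ∧ γ 0 = σ ∧
      ∀ h : T → ℂ, MDifferentiableAt 𝓘(ℝ, F) 𝓘(ℝ, ℂ) h σ →
        HasDerivAt (fun t => h (γ t)) (mvfderiv 𝓘(ℝ, F) h σ v) 0 := by
  obtain ⟨ψ, hψ, hψU⟩ := exists_isLocalParam (E := F) σ hU
  obtain ⟨w, hw⟩ := hψ.exists_mfderiv_eq v
  have hl : ContDiff ℝ ∞ (fun t : ℝ => chartAt F σ σ + t • w) := by fun_prop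
  refine ⟨fun t => ψ (chartAt F σ σ + t • w), hψ.contMDiff.comp hl.contMDiff,
    fun t => hψU _, by simp [hψ.apply_chart], fun h hh => ?_⟩
  rw [← hw h hh]
  have h1 : MDifferentiableAt 𝓘(ℝ, F) 𝓘(ℝ, ℂ) (h ∘ ψ) (chartAt F σ σ) := by
    refine MDifferentiableAt.comp (I' := 𝓘(ℝ, F)) _ ?_ (hψ.contMDiff.mdifferentiable (by simp) _)
    rwa [hψ.apply_chart]
  have h2 : HasDerivAt (fun t : ℝ => chartAt F σ σ + t • w) w 0 := by
    simpa using ((hasDerivAt_id (0 : ℝ)).smul_const w).const_add (chartAt F σ σ)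
  have h3 := h1.differentiableAt.hasFDerivAt
  exact HasFDerivAt.comp_hasDerivAt_of_eq (0 : ℝ) h3 h2 (by simp)

omit [FiniteDimensional ℝ F] [FiniteDimensional ℝ E] [T2Space M] [IsManifold 𝓘(ℝ, F) ∞ T]
  [IsManifold 𝓘(ℝ, E) ∞ M] in
theorem IsSmoothFamily.mdifferentiable {f : T → SmoothFun E M} (hf : IsSmoothFamily F f) (x : M) :
    MDifferentiable 𝓘(ℝ, F) 𝓘(ℝ, ℂ) (fun σ => (f σ : M → ℂ) x) :=
  ContMDiff.mdifferentiable (n := ∞) (ContMDiff.comp hf (contMDiff_id.prodMk contMDiff_const))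
    (by simp)

/-- The product rule for a smooth family of differential operators acting on a smooth family. -/
theorem IsSmoothOpFamily.mvfderiv_apply {Q : T → Module.End ℂ (SmoothFun E M)}
    (hQ : IsSmoothOpFamily F Q) {f : T → SmoothFun E M} (hf : IsSmoothFamily F f)
    (V : SmoothVectorField F T) (σ : T) (x : M) :
    mvfderiv 𝓘(ℝ, F) (fun τ => (Q τ (f τ) : M → ℂ) x) σ (V σ) =
      mvfderiv 𝓘(ℝ, F) (fun τ => (Q τ (f σ) : M → ℂ) x) σ (V σ) +
        (Q σ (derivAlong V f hf σ) : M → ℂ) x := by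
  obtain ⟨N, hN⟩ := hQ.order σ
  obtain ⟨γ, hγ, hγN, hγ0, hγd⟩ := exists_curve σ (V σ) hN
  -- Along the curve `f = f_σ + t w_t`, hence `Q f = Q f_σ + t Q(w_t)`. The last term has derivative
  -- `Q_σ(w_0)` at `t = 0`, and `w_0` is the derivative of `f`.
  obtain ⟨w, hw, hfw, hw0⟩ := exists_dividedDifference (hf.comp hγ)
  have h1 := hγd _ ((hQ.smooth hf).mdifferentiable x σ)
  have h2 := hγd _ ((hQ.smooth_const (f σ)).mdifferentiable x σ)
  have h3 := IsDiffOpLT.isSmoothFamily_apply N hγN (fun g => (hQ.smooth_const g).comp hγ) hw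
  have h4 : ContDiff ℝ ∞ (fun t => (Q (γ t) (w t) : M → ℂ) x) :=
    h3.contDiff_comp contMDiff_id contMDiff_const
  have h5 := ((hasDerivAt_id (0 : ℝ)).ofReal_comp).mul
    ((h4.differentiable (by simp) 0).hasDerivAt)
  have h6 := h2.add h5
  have hw0' : w 0 = derivAlong V f hf σ := by
    ext y
    rw [hw0]
    exact (hγd _ (hf.mdifferentiable y σ)).deriv
  have h7 : (fun t => (Q (γ t) (f (γ t)) : M → ℂ) x) = (fun t => (Q (γ t) (f σ) : M → ℂ) x) +
      ((fun t : ℝ => ((id t : ℝ) : ℂ)) * fun t => (Q (γ t) (w t) : M → ℂ) x) := by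
    ext t
    rw [hfw t, map_add, map_smul, hγ0]
    rfl
  rw [h7] at h1
  rw [h1.unique h6]
  simp [hγ0, hw0']

end Action

/-! ### Extension of coordinate vector fields -/

section CoordinateFields

variable {F : Type*} [NormedAddCommGroup F] [NormedSpace ℝ F] [FiniteDimensional ℝ F]
  {T : Type*} [TopologicalSpace T] [T2Space T] [ChartedSpace F T] [IsManifold 𝓘(ℝ, F) ∞ T]

/-- Smoothness and closedness of forms are tested on global vector fields only. Coordinate fields
are therefore made global: the constant vector in the tangent trivialisation is multiplied by a bump
function equal to one near `σ₀`. -/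
theorem IsLocalParam.exists_vectorField {σ₀ : T} {ψ : F → T} (hψ : IsLocalParam σ₀ ψ) (v : F) :
    ∃ V : SmoothVectorField F T, ∀ᶠ w in 𝓝 (chartAt F σ₀ σ₀),
      V (ψ w) = mfderiv 𝓘(ℝ, F) 𝓘(ℝ, F) ψ w v := by
  let e := trivializationAt F (TangentSpace 𝓘(ℝ, F) : T → Type _) σ₀
  let s : ∀ σ : T, TangentSpace 𝓘(ℝ, F) σ := fun σ => e.symmL ℝ σ v
  have : IsManifold 𝓘(ℝ, F) (∞ + 1) T := by
    simpa using (inferInstance : IsManifold 𝓘(ℝ, F) ∞ T)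
  have hs : ContMDiffOn 𝓘(ℝ, F) 𝓘(ℝ, F).tangent ∞
      (fun σ : T => (⟨σ, s σ⟩ : TangentBundle 𝓘(ℝ, F) T)) e.baseSet := by
    rw [e.contMDiffOn_section_baseSet_iff]
    refine (contMDiffOn_const (c := v)).congr fun y hy => ?_
    simp [s, hy]
  obtain ⟨χ⟩ : Nonempty (SmoothBumpFunction 𝓘(ℝ, F) σ₀) := inferInstance
  have hsub : tsupport χ ⊆ e.baseSet := χ.tsupport_subset_chartAt_source
  have hV : ContMDiff 𝓘(ℝ, F) 𝓘(ℝ, F).tangent ∞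
      (fun σ : T => (⟨σ, χ σ • s σ⟩ : TangentBundle 𝓘(ℝ, F) T)) :=
    ContMDiffOn.smul_section_of_tsupport (χ.contMDiff.contMDiffOn) e.open_baseSet hsub hs
  refine ⟨⟨fun σ => χ σ • s σ, hV⟩, ?_⟩
  have h1 : ∀ᶠ w in 𝓝 (chartAt F σ₀ σ₀), χ (ψ w) = 1 :=
    (hψ.contMDiff.continuous.continuousAt (x := chartAt F σ₀ σ₀)).eventually
      (by rw [hψ.apply_chart]; exact χ.eventuallyEq_one)
  filter_upwards [h1, hψ.eventuallyEq.eventuallyEq_nhds,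
    (chartAt F σ₀).open_target.mem_nhds (mem_chart_target F σ₀)] with w hw hw' hwt
  have h2 : ψ w ∈ (chartAt F σ₀).source := by
    rw [hw'.self_of_nhds]; exact (chartAt F σ₀).map_target hwt
  have h3 : chartAt F σ₀ (ψ w) = w := by
    rw [hw'.self_of_nhds]; exact (chartAt F σ₀).right_inv hwt
  change χ (ψ w) • s (ψ w) = _
  rw [hw, one_smul, hw'.mfderiv_eq]
  change e.symmL ℝ (ψ w) v = _
  rw [TangentBundle.symmL_trivializationAt h2]
  simp only [mfld_simps, mfderivWithin_univ]
  exact congrArg (fun z : F => (show F →L[ℝ] F from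
    mfderiv 𝓘(ℝ, F) 𝓘(ℝ, F) (chartAt F σ₀).symm z) v) h3

end CoordinateFields

/-! ### Functions with prescribed derivative -/

section BasePoint

variable {T : Type*} [TopologicalSpace T]

/-- A chosen point in the connected component of `σ`. -/
def basePoint (σ : T) : T := Quotient.out (σ : ConnectedComponents T)

theorem mk_basePoint (σ : T) : ConnectedComponents.mk (basePoint σ) = ConnectedComponents.mk σ := Quotient.out_eq _

theorem basePoint_mem (σ : T) : basePoint σ ∈ connectedComponent σ := by
  rw [← ConnectedComponents.coe_eq_coe.1 (mk_basePoint σ)]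
  exact mem_connectedComponent

theorem basePoint_eq {σ τ : T} (h : τ ∈ connectedComponent σ) : basePoint τ = basePoint σ := by
  unfold basePoint
  rw [ConnectedComponents.coe_eq_coe'.2 h]

/-- A locally constant property is constant on connected components. This replaces continuation
along paths. -/
theorem forall_of_basePoint {p : T → Prop} (hp : ∀ σ₀, ∀ᶠ σ in 𝓝 σ₀, (p σ ↔ p σ₀))
    (hb : ∀ σ, p (basePoint σ)) (σ : T) : p σ := by
  have h1 : IsLocallyConstant p :=
    (IsLocallyConstant.iff_eventually_eq p).2 fun σ₀ => (hp σ₀).mono fun σ h => propext h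
  have h2 := h1.apply_eq_of_isPreconnected isPreconnected_connectedComponent
    (basePoint_mem σ) mem_connectedComponent
  exact h2 ▸ hb σ

end BasePoint

/-! ### Smoothness of primitives -/

section Primitive

variable {F : Type*} [NormedAddCommGroup F] [NormedSpace ℝ F] [FiniteDimensional ℝ F]
  {T : Type*} [TopologicalSpace T] [T2Space T] [ChartedSpace F T] [IsManifold 𝓘(ℝ, F) ∞ T]

omit [T2Space T] in
-- The point is the order of quantifiers: `W` depends on `U` alone and so serves all functions `h`
-- at once. It is the set on which `ψ` inverts the chart, and `h ∘ ψ` is constant since `ψ` takes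
-- values in `U`.
theorem exists_nhds_eq_of_mvfderiv_eq_zero (σ₀ : T) {U : Set T} (hU : U ∈ 𝓝 σ₀) :
    ∃ W ∈ 𝓝 σ₀, ∀ h : T → ℂ, MDifferentiable 𝓘(ℝ, F) 𝓘(ℝ, ℂ) h →
      (∀ σ ∈ U, ∀ v, mvfderiv 𝓘(ℝ, F) h σ v = 0) → ∀ σ ∈ W, h σ = h σ₀ := by
  obtain ⟨ψ, hψ, hψU⟩ := exists_isLocalParam (E := F) σ₀ hU
  refine ⟨_, hψ.eventually_apply_chart, fun h hh h0 σ hσ => ?_⟩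
  have hψd : MDifferentiable 𝓘(ℝ, F) 𝓘(ℝ, F) ψ := hψ.contMDiff.mdifferentiable (by simp)
  have hd : Differentiable ℝ (h ∘ ψ) := (hh.comp hψd).differentiable
  have hz : ∀ w, fderiv ℝ (h ∘ ψ) w = 0 := by
    intro w
    ext v
    rw [← mfderiv_eq_fderiv]
    exact (mfderiv_comp_apply w (hh _) (hψd w) v).trans (h0 _ (hψU w) _)
  have := is_const_of_fderiv_eq_zero hd hz (chartAt F σ₀ σ) (chartAt F σ₀ σ₀)
  simpa [hψ.apply_chart, show ψ (chartAt F σ₀ σ) = σ from hσ] using this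

omit [T2Space T] in
theorem eventually_basePoint_eq (F : Type*) [NormedAddCommGroup F] [NormedSpace ℝ F]
    {T : Type*} [TopologicalSpace T] [ChartedSpace F T] (σ₀ : T) :
    ∀ᶠ σ in 𝓝 σ₀, basePoint σ = basePoint σ₀ := by
  have : LocallyConnectedSpace T := ChartedSpace.locallyConnectedSpace F T
  filter_upwards [isOpen_connectedComponent.mem_nhds (mem_connectedComponent (x := σ₀))] with σ hσ
  exact basePoint_eq hσ

omit [T2Space T] in
theorem eq_basePoint_of_mvfderiv_eq_zero {h : T → ℂ} (hh : MDifferentiable 𝓘(ℝ, F) 𝓘(ℝ, ℂ) h)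
    (h0 : ∀ σ v, mvfderiv 𝓘(ℝ, F) h σ v = 0) (σ : T) : h σ = h (basePoint σ) := by
  refine forall_of_basePoint (p := fun σ => h σ = h (basePoint σ)) (fun σ₀ => ?_) (fun σ => ?_) σ
  · obtain ⟨W, hW, hWh⟩ := exists_nhds_eq_of_mvfderiv_eq_zero (F := F) σ₀ univ_mem
    filter_upwards [hW, eventually_basePoint_eq F σ₀] with σ h1 h2
    rw [hWh h hh (fun σ _ v => h0 σ v) σ h1, h2]
  · rw [basePoint_eq (basePoint_mem σ)]

variable {E : Type*} [NormedAddCommGroup E] [NormedSpace ℝ E] [FiniteDimensional ℝ E]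
  {M : Type*} [TopologicalSpace M] [ChartedSpace E M] [IsManifold 𝓘(ℝ, E) ∞ M]

/-- A function whose derivative in the parameter is a smooth family differs, near a given
parameter, by a smooth function from its value at that parameter. -/
theorem exists_local_primitive {h : T → M → ℂ}
    {B : ∀ σ : T, TangentSpace 𝓘(ℝ, F) σ →ₗ[ℝ] SmoothFun E M}
    (hB : ∀ V : SmoothVectorField F T, IsSmoothFamily F (fun σ => B σ (V σ)))
    (hd : ∀ x, MDifferentiable 𝓘(ℝ, F) 𝓘(ℝ, ℂ) (fun σ => h σ x))
    (hBd : ∀ x σ v, mvfderiv 𝓘(ℝ, F) (fun τ => h τ x) σ v = (B σ v : M → ℂ) x) (σ₀ : T) :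
    ∃ I : F → M → ℂ, ContMDiff (𝓘(ℝ, F).prod 𝓘(ℝ, E)) 𝓘(ℝ, ℂ) ∞ (fun p : F × M => I p.1 p.2) ∧
      ∀ᶠ σ in 𝓝 σ₀, ∀ x, h σ x = h σ₀ x + I (chartAt F σ₀ σ) x := by
  obtain ⟨ψ, hψ, -⟩ := exists_isLocalParam (E := F) σ₀ (univ_mem (f := 𝓝 σ₀))
  let b := Module.finBasis ℝ F
  set c := chartAt F σ₀ σ₀ with hc
  choose V hV using fun i => hψ.exists_vectorField (b i)
  -- A ball is convex, so segments from its centre stay where the global fields `V i` agree with the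
  -- coordinate fields.
  obtain ⟨ε, hε, hεV⟩ := Metric.eventually_nhds_iff_ball.1 (eventually_all.2 hV)
  have hψd : MDifferentiable 𝓘(ℝ, F) 𝓘(ℝ, F) ψ := hψ.contMDiff.mdifferentiable (by simp)
  -- For `w` in this ball, `G w x t` is the derivative of `h` along the segment from `c` to `w`,
  -- expanded in the fields `V i`, for which `B` is known to be smooth.
  let G : F → M → ℝ → ℂ := fun w x t => ∑ i, ((b.repr (w - c) i : ℝ) : ℂ) *
    (B (ψ (c + t • (w - c))) (V i (ψ (c + t • (w - c)))) : M → ℂ) x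
  have hGs : ∀ {χ : E → M}, ContMDiff 𝓘(ℝ, E) 𝓘(ℝ, E) ∞ χ →
      ContDiff ℝ ∞ (fun q : (F × E) × ℝ => G q.1.1 (χ q.1.2) q.2) := by
    intro χ hχ
    refine ContDiff.sum fun i _ => ContDiff.mul ?_ ?_
    · exact Complex.ofRealCLM.contDiff.comp
        ((LinearMap.toContinuousLinearMap (b.coord i)).contDiff.comp (by fun_prop))
    · have h1 : ContDiff ℝ ∞ (fun q : (F × E) × ℝ => c + q.2 • (q.1.1 - c)) := by fun_prop
      have h2 : ContDiff ℝ ∞ (fun q : (F × E) × ℝ => q.1.2) := by fun_prop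
      exact (hB (V i)).contDiff_comp (hψ.contMDiff.comp h1.contMDiff) (hχ.comp h2.contMDiff)
  refine ⟨fun w x => ∫ t in (0 : ℝ)..1, G w x t, ?_, ?_⟩
  · rintro ⟨w₀, x₀⟩
    obtain ⟨χ, hχ, -⟩ := exists_isLocalParam (E := E) x₀ (univ_mem (f := 𝓝 x₀))
    refine contMDiffAt_of_isLocalParam (isLocalParam_id w₀) hχ (ContDiff.contDiffAt ?_)
    exact contDiff_parametric_integral (f := fun (p : F × E) t => G p.1 (χ p.2) t)
      (hGs hχ.contMDiff)
  have hball : ∀ᶠ σ in 𝓝 σ₀, chartAt F σ₀ σ ∈ Metric.ball c ε :=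
    ((chartAt F σ₀).continuousAt (mem_chart_source F σ₀)).eventually (Metric.ball_mem_nhds c hε)
  filter_upwards [hψ.eventually_apply_chart, hball] with σ hσ hσb x
  set w := chartAt F σ₀ σ with hw
  obtain ⟨χ, hχ, -⟩ := exists_isLocalParam (E := E) x (univ_mem (f := 𝓝 x))
  have hGc : Continuous (G w x) := by
    have := (hGs hχ.contMDiff).continuous.comp
      (by fun_prop : Continuous fun t : ℝ => ((w, chartAt E x x), t))
    simpa [Function.comp_def, hχ.apply_chart] using this
  have hder : ∀ t ∈ Set.uIcc (0 : ℝ) 1,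
      HasDerivAt (fun t : ℝ => h (ψ (c + t • (w - c))) x) (G w x t) t := by
    intro t ht
    rw [Set.uIcc_of_le zero_le_one] at ht
    set z := c + t • (w - c) with hz
    have hzb : z ∈ Metric.ball c ε := by
      rw [Metric.mem_ball, hz, dist_self_add_left, norm_smul, Real.norm_of_nonneg ht.1]
      rw [Metric.mem_ball, dist_eq_norm] at hσb
      exact (mul_le_of_le_one_left (norm_nonneg _) ht.2).trans_lt hσb
    have h1 : HasFDerivAt ((fun τ => h τ x) ∘ ψ) (fderiv ℝ ((fun τ => h τ x) ∘ ψ) z) z :=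
      ((hd x).comp hψd).differentiable.differentiableAt.hasFDerivAt
    have h2 : HasDerivAt (fun t : ℝ => c + t • (w - c)) (w - c) t := by
      simpa using ((hasDerivAt_id t).smul_const (w - c)).const_add c
    have h3 := HasFDerivAt.comp_hasDerivAt_of_eq t h1 h2 rfl
    have h4 : fderiv ℝ ((fun τ => h τ x) ∘ ψ) z (w - c) = G w x t := by
      rw [← mfderiv_eq_fderiv]
      have h5 := (mfderiv_comp_apply z (hd x _) (hψd z) (w - c)).trans (hBd x _ _)
      refine h5.trans ?_
      have h6 : mfderiv 𝓘(ℝ, F) 𝓘(ℝ, F) ψ z (w - c) =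
          ∑ i, b.repr (w - c) i • V i (ψ z) := by
        conv_lhs => rw [← b.sum_repr (w - c)]
        refine (map_sum (mfderiv 𝓘(ℝ, F) 𝓘(ℝ, F) ψ z) _ _).trans ?_
        refine Finset.sum_congr rfl fun i _ => ?_
        rw [hεV z hzb i]
        exact map_smul (mfderiv 𝓘(ℝ, F) 𝓘(ℝ, F) ψ z) _ _
      rw [h6, map_sum, AddSubmonoidClass.coe_finsetSum, Finset.sum_apply]
      refine Finset.sum_congr rfl fun i _ => ?_
      rw [map_smul]
      rfl
    rw [← h4]
    exact h3
  rw [intervalIntegral.integral_eq_sub_of_hasDerivAt hder (hGc.intervalIntegrable _ _)]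
  simp [hσ, hc, hψ.apply_chart]

/-- Two nearby slices differ by a smooth function of `x`, so smoothness of a slice is a locally
constant property and spreads from the base points. Joint smoothness then follows from the local
formula `h σ = h σ₀ + I`. -/
theorem contMDiff_of_mvfderiv_eq {h : T → M → ℂ}
    {B : ∀ σ : T, TangentSpace 𝓘(ℝ, F) σ →ₗ[ℝ] SmoothFun E M}
    (hB : ∀ V : SmoothVectorField F T, IsSmoothFamily F (fun σ => B σ (V σ)))
    (hd : ∀ x, MDifferentiable 𝓘(ℝ, F) 𝓘(ℝ, ℂ) (fun σ => h σ x))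
    (hBd : ∀ x σ v, mvfderiv 𝓘(ℝ, F) (fun τ => h τ x) σ v = (B σ v : M → ℂ) x)
    (hb : ∀ σ, ContMDiff 𝓘(ℝ, E) 𝓘(ℝ, ℂ) ∞ (h (basePoint σ))) :
    ContMDiff (𝓘(ℝ, F).prod 𝓘(ℝ, E)) 𝓘(ℝ, ℂ) ∞ (fun p : T × M => h p.1 p.2) := by
  have hslice : ∀ σ, ContMDiff 𝓘(ℝ, E) 𝓘(ℝ, ℂ) ∞ (h σ) := by
    refine forall_of_basePoint (fun σ₀ => ?_) hb
    obtain ⟨I, hI, hhI⟩ := exists_local_primitive hB hd hBd σ₀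
    filter_upwards [hhI] with σ hσ
    have h1 : ContMDiff 𝓘(ℝ, E) 𝓘(ℝ, ℂ) ∞ (I (chartAt F σ₀ σ)) :=
      hI.comp (contMDiff_const.prodMk contMDiff_id)
    refine ⟨fun h2 => (h2.sub h1).congr fun x => ?_, fun h2 => (h2.add h1).congr fun x => ?_⟩
    · simp [hσ x]
    · simp [hσ x]
  rintro ⟨σ₀, x₀⟩
  obtain ⟨I, hI, hhI⟩ := exists_local_primitive hB hd hBd σ₀
  have h1 : ContMDiffAt (𝓘(ℝ, F).prod 𝓘(ℝ, E)) (𝓘(ℝ, F).prod 𝓘(ℝ, E)) ∞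
      (fun p : T × M => (chartAt F σ₀ p.1, p.2)) (σ₀, x₀) :=
    ((contMDiffAt_of_mem_maximalAtlas (IsManifold.chart_mem_maximalAtlas (I := 𝓘(ℝ, F)) σ₀)
      (mem_chart_source F σ₀)).comp (σ₀, x₀) contMDiffAt_fst).prodMk contMDiffAt_snd
  have h2 : ContMDiffAt (𝓘(ℝ, F).prod 𝓘(ℝ, E)) 𝓘(ℝ, ℂ) ∞
      (fun p : T × M => h σ₀ p.2 + I (chartAt F σ₀ p.1) p.2) (σ₀, x₀) :=
    ((hslice σ₀).contMDiffAt.comp (σ₀, x₀) contMDiffAt_snd).add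
      (hI.contMDiffAt.comp (σ₀, x₀) h1)
  refine h2.congr_of_eventuallyEq ?_
  filter_upwards [hhI.prod_inl_nhds x₀] with p hp
  exact hp p.2

end Primitive

/-! ### Primitives of closed forms -/

section ClosedForms

variable {F : Type*} [NormedAddCommGroup F] [NormedSpace ℝ F]
  {T : Type*} [TopologicalSpace T] [ChartedSpace F T]

theorem mvfderiv_clm_comp {Y Z : Type*} [NormedAddCommGroup Y] [NormedSpace ℝ Y]
    [NormedAddCommGroup Z] [NormedSpace ℝ Z] (L : Y →L[ℝ] Z) {f : T → Y} {σ : T}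
    (hf : MDifferentiableAt 𝓘(ℝ, F) 𝓘(ℝ, Y) f σ) (v : TangentSpace 𝓘(ℝ, F) σ) :
    mvfderiv 𝓘(ℝ, F) (fun τ => L (f τ)) σ v = L (mvfderiv 𝓘(ℝ, F) f σ v) := by
  have h1 := mfderiv_comp_apply (I' := 𝓘(ℝ, Y)) (I'' := 𝓘(ℝ, Z)) (g := L) σ
    L.differentiableAt.mdifferentiableAt hf v
  rw [mfderiv_eq_fderiv, L.fderiv] at h1
  exact h1

theorem mvfderiv_fun_add_apply {f g : T → ℂ} {σ : T} (hf : MDifferentiableAt 𝓘(ℝ, F) 𝓘(ℝ, ℂ) f σ)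
    (hg : MDifferentiableAt 𝓘(ℝ, F) 𝓘(ℝ, ℂ) g σ) (v : TangentSpace 𝓘(ℝ, F) σ) :
    mvfderiv 𝓘(ℝ, F) (fun τ => f τ + g τ) σ v =
      mvfderiv 𝓘(ℝ, F) f σ v + mvfderiv 𝓘(ℝ, F) g σ v :=
  congrArg (fun A : TangentSpace 𝓘(ℝ, F) σ →L[ℝ] ℂ => A v) (mvfderiv_add hf hg)

theorem mvfderiv_fun_sub_apply {f g : T → ℂ} {σ : T} (hf : MDifferentiableAt 𝓘(ℝ, F) 𝓘(ℝ, ℂ) f σ)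
    (hg : MDifferentiableAt 𝓘(ℝ, F) 𝓘(ℝ, ℂ) g σ) (v : TangentSpace 𝓘(ℝ, F) σ) :
    mvfderiv 𝓘(ℝ, F) (fun τ => f τ - g τ) σ v =
      mvfderiv 𝓘(ℝ, F) f σ v - mvfderiv 𝓘(ℝ, F) g σ v :=
  congrArg (fun A : TangentSpace 𝓘(ℝ, F) σ →L[ℝ] ℂ => A v) (mvfderiv_sub hf hg)

variable [FiniteDimensional ℝ F] [IsManifold 𝓘(ℝ, F) ∞ T]

theorem exists_primitive_real (hT : Subsingleton (deRhamH1 F T)) {α : CovectorFamily F T}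
    (hs : IsSmoothForm α) (hc : IsClosedForm α) :
    ∃ g : T → ℝ, ContMDiff 𝓘(ℝ, F) 𝓘(ℝ, ℝ) ∞ g ∧
      ∀ (σ : T) (v : TangentSpace 𝓘(ℝ, F) σ), α σ v = mvfderiv 𝓘(ℝ, F) g σ v := by
  have h1 := Submodule.Quotient.subsingleton_iff.1 hT
  have h2 : (⟨α, hs, hc⟩ : closedForms F T) ∈
      (exactForms F T).comap (closedForms F T).subtype := by rw [h1]; trivial
  exact h2

theorem exists_primitive_of_clm (hT : Subsingleton (deRhamH1 F T))
    {B : ∀ σ : T, TangentSpace 𝓘(ℝ, F) σ →ₗ[ℝ] ℂ}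
    (hs : ∀ V : SmoothVectorField F T, ContMDiff 𝓘(ℝ, F) 𝓘(ℝ, ℂ) ∞ (fun σ => B σ (V σ)))
    (hc : ∀ (V W : SmoothVectorField F T) (σ : T),
      mvfderiv 𝓘(ℝ, F) (fun τ => B τ (W τ)) σ (V σ) - mvfderiv 𝓘(ℝ, F) (fun τ => B τ (V τ)) σ (W σ)
        - B σ (VectorField.mlieBracket 𝓘(ℝ, F) V W σ) = 0) (L : ℂ →L[ℝ] ℝ) :
    ∃ g : T → ℝ, ContMDiff 𝓘(ℝ, F) 𝓘(ℝ, ℝ) ∞ g ∧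
      ∀ (σ : T) (v : TangentSpace 𝓘(ℝ, F) σ), L (B σ v) = mvfderiv 𝓘(ℝ, F) g σ v := by
  have i₁ : ∀ σ : T, FiniteDimensional ℝ (TangentSpace 𝓘(ℝ, F) σ) :=
    fun _ => inferInstanceAs (FiniteDimensional ℝ F)
  have i₂ : ∀ σ : T, T2Space (TangentSpace 𝓘(ℝ, F) σ) := fun _ => inferInstanceAs (T2Space F)
  let α : CovectorFamily F T := fun σ => LinearMap.toContinuousLinearMap (L.toLinearMap ∘ₗ B σ)
  have hα : ∀ σ v, α σ v = L (B σ v) := fun σ v => rfl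
  refine exists_primitive_real hT (α := α) (fun V => ?_) (fun V W σ => ?_)
  · exact L.contDiff.contMDiff.comp (hs V)
  · simp only [hα]
    rw [mvfderiv_clm_comp L ((hs W).mdifferentiable (by simp) σ),
      mvfderiv_clm_comp L ((hs V).mdifferentiable (by simp) σ), ← map_sub, ← map_sub, hc, map_zero]

/-- Real and imaginary parts are treated separately. The normalisation at the base points makes the
primitive unique, which later yields linearity. -/
theorem exists_primitive (hT : Subsingleton (deRhamH1 F T))
    {B : ∀ σ : T, TangentSpace 𝓘(ℝ, F) σ →ₗ[ℝ] ℂ}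
    (hs : ∀ V : SmoothVectorField F T, ContMDiff 𝓘(ℝ, F) 𝓘(ℝ, ℂ) ∞ (fun σ => B σ (V σ)))
    (hc : ∀ (V W : SmoothVectorField F T) (σ : T),
      mvfderiv 𝓘(ℝ, F) (fun τ => B τ (W τ)) σ (V σ) - mvfderiv 𝓘(ℝ, F) (fun τ => B τ (V τ)) σ (W σ)
        - B σ (VectorField.mlieBracket 𝓘(ℝ, F) V W σ) = 0) :
    ∃ p : T → ℂ, MDifferentiable 𝓘(ℝ, F) 𝓘(ℝ, ℂ) p ∧
      (∀ (σ : T) (v : TangentSpace 𝓘(ℝ, F) σ), mvfderiv 𝓘(ℝ, F) p σ v = B σ v) ∧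
      ∀ σ, p (basePoint σ) = 0 := by
  obtain ⟨g₁, hg₁, hd₁⟩ := exists_primitive_of_clm hT hs hc Complex.reCLM
  obtain ⟨g₂, hg₂, hd₂⟩ := exists_primitive_of_clm hT hs hc Complex.imCLM
  have m₁ := hg₁.mdifferentiable (n := ∞) (by simp)
  have m₂ := hg₂.mdifferentiable (n := ∞) (by simp)
  let L₂ : ℝ →L[ℝ] ℂ := (ContinuousLinearMap.mul ℝ ℂ Complex.I).comp Complex.ofRealCLM
  let q : T → ℂ := (fun τ => Complex.ofRealCLM (g₁ τ)) + fun τ => L₂ (g₂ τ)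
  have M₁ : MDifferentiable 𝓘(ℝ, F) 𝓘(ℝ, ℂ) (fun τ => Complex.ofRealCLM (g₁ τ)) :=
    (Complex.ofRealCLM.contDiff.contMDiff.comp hg₁).mdifferentiable (n := ∞) (by simp)
  have M₂ : MDifferentiable 𝓘(ℝ, F) 𝓘(ℝ, ℂ) (fun τ => L₂ (g₂ τ)) :=
    (L₂.contDiff.contMDiff.comp hg₂).mdifferentiable (n := ∞) (by simp)
  have hq : MDifferentiable 𝓘(ℝ, F) 𝓘(ℝ, ℂ) q := M₁.add M₂
  have hqd : ∀ (σ : T) (v : TangentSpace 𝓘(ℝ, F) σ), mvfderiv 𝓘(ℝ, F) q σ v = B σ v := by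
    intro σ v
    rw [mvfderiv_add (M₁ σ) (M₂ σ)]
    change mvfderiv 𝓘(ℝ, F) (fun τ => Complex.ofRealCLM (g₁ τ)) σ v +
      mvfderiv 𝓘(ℝ, F) (fun τ => L₂ (g₂ τ)) σ v = _
    rw [mvfderiv_clm_comp _ (m₁ σ), mvfderiv_clm_comp _ (m₂ σ), ← hd₁, ← hd₂]
    simp only [L₂, Complex.reCLM_apply, Complex.imCLM_apply, ContinuousLinearMap.comp_apply,
      Complex.ofRealCLM_apply, ContinuousLinearMap.mul_apply']
    rw [mul_comm]
    exact Complex.re_add_im _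
  -- The value at the base point is locally constant in `σ`, so subtracting it does not change the
  -- derivative.
  let r : T → ℂ := fun σ => q (basePoint σ)
  have hr : ∀ σ, r =ᶠ[𝓝 σ] fun _ => r σ := fun σ =>
    (eventually_basePoint_eq F σ).mono fun τ h => congrArg q h
  have hrm : MDifferentiable 𝓘(ℝ, F) 𝓘(ℝ, ℂ) r := fun σ =>
    (mdifferentiableAt_const (c := r σ)).congr_of_eventuallyEq (hr σ)
  have hrd : ∀ σ, mvfderiv 𝓘(ℝ, F) r σ = 0 := by
    intro σ
    have h1 : mfderiv 𝓘(ℝ, F) 𝓘(ℝ, ℂ) r σ = mfderiv 𝓘(ℝ, F) 𝓘(ℝ, ℂ) (fun _ => r σ) σ :=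
      (hr σ).mfderiv_eq
    exact h1.trans (mfderiv_const ..)
  refine ⟨q - r, hq.sub hrm, fun σ v => ?_, fun σ => ?_⟩
  · rw [mvfderiv_sub (hq σ) (hrm σ), hrd, sub_zero, hqd]
  · simp [r, basePoint_eq (basePoint_mem σ)]

end ClosedForms

/-! ### Families of differential operators with prescribed derivative -/

section OpPrimitive

variable {F : Type*} [NormedAddCommGroup F] [NormedSpace ℝ F]
  {T : Type*} [TopologicalSpace T] [ChartedSpace F T]
  {E : Type*} [NormedAddCommGroup E] [NormedSpace ℝ E]
  {M : Type*} [TopologicalSpace M] [ChartedSpace E M]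

/-- The operator-valued form `B` is the derivative of the family `Q`. -/
def HasOpDeriv (Q : T → Module.End ℂ (SmoothFun E M))
    (B : ∀ σ : T, TangentSpace 𝓘(ℝ, F) σ → Module.End ℂ (SmoothFun E M)) : Prop :=
  ∀ (g : SmoothFun E M) (x : M), MDifferentiable 𝓘(ℝ, F) 𝓘(ℝ, ℂ) (fun τ => (Q τ g : M → ℂ) x) ∧
    ∀ (σ : T) (v : TangentSpace 𝓘(ℝ, F) σ),
      mvfderiv 𝓘(ℝ, F) (fun τ => (Q τ g : M → ℂ) x) σ v = (B σ v g : M → ℂ) x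

theorem HasOpDeriv.commMul {Q : T → Module.End ℂ (SmoothFun E M)}
    {B : ∀ σ : T, TangentSpace 𝓘(ℝ, F) σ → Module.End ℂ (SmoothFun E M)} (h : HasOpDeriv Q B)
    (u : SmoothFun E M) :
    HasOpDeriv (fun σ => commMul (Q σ) u) (fun σ v => commMul (B σ v) u) := by
  intro g x
  obtain ⟨h1, h2⟩ := h (u * g) x
  obtain ⟨h3, h4⟩ := h g x
  let L : ℂ →L[ℝ] ℂ := ContinuousLinearMap.mul ℝ ℂ ((u : M → ℂ) x)
  have h5 : MDifferentiable 𝓘(ℝ, F) 𝓘(ℝ, ℂ) (fun τ => L ((Q τ g : M → ℂ) x)) := fun σ =>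
    L.differentiableAt.mdifferentiableAt.comp σ (h3 σ)
  refine ⟨h1.sub h5, fun σ v => ?_⟩
  refine (mvfderiv_fun_sub_apply (h1 σ) (h5 σ) v).trans ?_
  rw [mvfderiv_clm_comp L (h3 σ), h2, h4]
  rfl

variable [FiniteDimensional ℝ F] [IsManifold 𝓘(ℝ, F) ∞ T]

/-- Commutators with functions commute with differentiation in `σ`, which permits induction on `N`.
For `N = 0` the derivative vanishes on a neighbourhood, and `Q` is constant on a smaller one. -/
theorem HasOpDeriv.eventually_isDiffOpLT_sub {Q : T → Module.End ℂ (SmoothFun E M)}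
    {B : ∀ σ : T, TangentSpace 𝓘(ℝ, F) σ → Module.End ℂ (SmoothFun E M)} (h : HasOpDeriv Q B)
    {σ₀ : T} {N : ℕ} (hN : ∀ᶠ σ in 𝓝 σ₀, ∀ v, IsDiffOpLT N (B σ v)) :
    ∀ᶠ σ in 𝓝 σ₀, IsDiffOpLT N (Q σ - Q σ₀) := by
  obtain ⟨W, hW, hWc⟩ := exists_nhds_eq_of_mvfderiv_eq_zero (F := F) σ₀ hN
  filter_upwards [hW] with σ hσ
  -- The set is abstracted to `U`, so that `Q` and `B` can be replaced by commutators while `U`, `W`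
  -- and `σ` stay fixed.
  replace hN : ∀ τ ∈ {τ : T | ∀ v, IsDiffOpLT N (B τ v)}, ∀ v, IsDiffOpLT N (B τ v) :=
    fun τ h => h
  generalize {τ : T | ∀ v, IsDiffOpLT N (B τ v)} = U at hN hWc
  induction N generalizing Q B with
  | zero =>
    refine LinearMap.ext fun g => Subtype.ext (funext fun x => ?_)
    have := hWc _ (h g x).1 (fun τ hτ v => by
      rw [(h g x).2, show B τ v = 0 from hN τ hτ v]; rfl) σ hσ
    exact sub_eq_zero.2 this
  | succ N ih =>
    intro u
    rw [commMul_sub]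
    exact ih (h.commMul u) (fun τ hτ v => hN τ hτ v u)

variable [T2Space T] [FiniteDimensional ℝ E] [IsManifold 𝓘(ℝ, E) ∞ M]

/-- The primitive is taken separately for each function `g` and point `x`. Uniqueness of normalised
primitives gives linearity in `g`, and the derivative `B` controls both smoothness in `(σ, x)` and
the order of the operator. -/
theorem exists_smoothOpFamily (hT : Subsingleton (deRhamH1 F T))
    (B : ∀ σ : T, TangentSpace 𝓘(ℝ, F) σ →ₗ[ℝ] Module.End ℂ (SmoothFun E M))
    (hord : ∀ σ₀ : T, ∃ N : ℕ, ∀ᶠ σ in 𝓝 σ₀, ∀ v, IsDiffOpLT N (B σ v))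
    (hsm : ∀ (V : SmoothVectorField F T) (g : SmoothFun E M),
      IsSmoothFamily F (fun σ => B σ (V σ) g))
    (hc : ∀ (V W : SmoothVectorField F T) (g : SmoothFun E M) (x : M) (σ : T),
      mvfderiv 𝓘(ℝ, F) (fun τ => (B τ (W τ) g : M → ℂ) x) σ (V σ)
        - mvfderiv 𝓘(ℝ, F) (fun τ => (B τ (V τ) g : M → ℂ) x) σ (W σ)
        - (B σ (VectorField.mlieBracket 𝓘(ℝ, F) V W σ) g : M → ℂ) x = 0)
    {P₀ : Module.End ℂ (SmoothFun E M)} {m : ℕ} (hP₀ : IsDiffOpLT m P₀) :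
    ∃ Q : T → Module.End ℂ (SmoothFun E M), IsSmoothOpFamily F Q ∧
      HasOpDeriv Q (fun σ v => B σ v) ∧ ∀ σ, Q (basePoint σ) = P₀ := by
  let Bg : SmoothFun E M → ∀ σ : T, TangentSpace 𝓘(ℝ, F) σ →ₗ[ℝ] SmoothFun E M := fun g σ =>
    { toFun := fun v => B σ v g
      map_add' := fun v w => by rw [map_add]; rfl
      map_smul' := fun r v => by rw [map_smul]; rfl }
  let Bgx : SmoothFun E M → M → ∀ σ : T, TangentSpace 𝓘(ℝ, F) σ →ₗ[ℝ] ℂ := fun g x σ =>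
    { toFun := fun v => (B σ v g : M → ℂ) x
      map_add' := fun v w => by rw [map_add]; rfl
      map_smul' := fun r v => by rw [map_smul]; rfl }
  have hex : ∀ g x, ∃ p : T → ℂ, MDifferentiable 𝓘(ℝ, F) 𝓘(ℝ, ℂ) p ∧
      (∀ (σ : T) (v : TangentSpace 𝓘(ℝ, F) σ), mvfderiv 𝓘(ℝ, F) p σ v = Bgx g x σ v) ∧
      ∀ σ, p (basePoint σ) = 0 := fun g x =>
    exists_primitive hT (B := Bgx g x)
      (fun V => ContMDiff.comp (hsm V g) (contMDiff_id.prodMk contMDiff_const))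
      (fun V W σ => hc V W g x σ)
  choose p hp hpd hp0 using hex
  -- Uniqueness of normalised primitives; additivity and homogeneity in `g` are both instances of
  -- it.
  have hzero : ∀ {q : T → ℂ}, MDifferentiable 𝓘(ℝ, F) 𝓘(ℝ, ℂ) q →
      (∀ σ v, mvfderiv 𝓘(ℝ, F) q σ v = 0) → (∀ σ, q (basePoint σ) = 0) → ∀ σ, q σ = 0 :=
    fun hq hqd hq0 σ => (eq_basePoint_of_mvfderiv_eq_zero hq hqd σ).trans (hq0 σ)
  have hadd : ∀ g g' x σ, p (g + g') x σ = p g x σ + p g' x σ := by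
    intro g g' x σ
    have h1 := (hp g x).add (hp g' x)
    have h2 := hzero ((hp (g + g') x).sub h1) (fun τ v => ?_) (fun τ => ?_) σ
    · exact sub_eq_zero.1 h2
    · refine (mvfderiv_fun_sub_apply (hp _ _ τ) (h1 τ) v).trans ?_
      refine (congrArg (_ - ·) (mvfderiv_fun_add_apply (hp _ _ τ) (hp _ _ τ) v)).trans ?_
      rw [hpd, hpd, hpd]
      change (B τ v (g + g') : M → ℂ) x - ((B τ v g : M → ℂ) x + (B τ v g' : M → ℂ) x) = 0
      rw [map_add]
      exact sub_self _
    · simp [hp0]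
  have hsmul : ∀ (c : ℂ) g x σ, p (c • g) x σ = c * p g x σ := by
    intro c g x σ
    let L : ℂ →L[ℝ] ℂ := ContinuousLinearMap.mul ℝ ℂ c
    have h1 : MDifferentiable 𝓘(ℝ, F) 𝓘(ℝ, ℂ) (fun τ => L (p g x τ)) := fun σ =>
      L.differentiableAt.mdifferentiableAt.comp σ (hp g x σ)
    have h2 := hzero ((hp (c • g) x).sub h1) (fun τ v => ?_) (fun τ => ?_) σ
    · exact sub_eq_zero.1 h2
    · refine (mvfderiv_fun_sub_apply (hp _ _ τ) (h1 τ) v).trans ?_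
      rw [mvfderiv_clm_comp L (hp g x τ), hpd, hpd]
      change (B τ v (c • g) : M → ℂ) x - c * (B τ v g : M → ℂ) x = 0
      rw [map_smul]
      exact sub_self _
    · simp [hp0]
  have hps : ∀ g, ContMDiff (𝓘(ℝ, F).prod 𝓘(ℝ, E)) 𝓘(ℝ, ℂ) ∞ (fun q : T × M => p g q.2 q.1) :=
    fun g => contMDiff_of_mvfderiv_eq (h := fun σ x => p g x σ) (B := Bg g) (fun V => hsm V g)
      (hp g) (fun x σ v => hpd g x σ v) (fun σ => by simpa [hp0] using contMDiff_const)
  let R : T → Module.End ℂ (SmoothFun E M) := fun σ =>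
    { toFun := fun g => ⟨fun x => p g x σ, (hps g).comp (contMDiff_const.prodMk contMDiff_id)⟩
      map_add' := fun g g' => Subtype.ext (funext fun x => hadd g g' x σ)
      map_smul' := fun c g => Subtype.ext (funext fun x => hsmul c g x σ) }
  have hRd : HasOpDeriv R (fun σ v => B σ v) := fun g x => ⟨hp g x, hpd g x⟩
  have hR0 : ∀ σ, R (basePoint σ) = 0 := fun σ =>
    LinearMap.ext fun g => Subtype.ext (funext fun x => hp0 g x σ)
  -- Only differences of nearby operators have controlled order. Finiteness of the order is thus a
  -- locally constant property, and it holds at the base points, where `R` vanishes.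
  have hRN : ∀ σ, ∃ n, IsDiffOpLT n (R σ) := by
    refine forall_of_basePoint (fun σ₀ => ?_) (fun σ => ⟨0, hR0 σ⟩)
    obtain ⟨N, hN⟩ := hord σ₀
    filter_upwards [hRd.eventually_isDiffOpLT_sub hN] with σ hσ
    refine ⟨fun ⟨n, hn⟩ => ⟨max n N, ?_⟩, fun ⟨n, hn⟩ => ⟨max n N, ?_⟩⟩
    · have := (hn.mono (le_max_left n N)).add (hσ.mono (le_max_right n N)).neg
      have e : R σ + -(R σ - R σ₀) = R σ₀ := LinearMap.ext fun g =>
        show R σ g + -(R σ g - R σ₀ g) = R σ₀ g by ring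
      rwa [e] at this
    · have := (hn.mono (le_max_left n N)).add (hσ.mono (le_max_right n N))
      have e : R σ₀ + (R σ - R σ₀) = R σ := LinearMap.ext fun g =>
        show R σ₀ g + (R σ g - R σ₀ g) = R σ g by ring
      rwa [e] at this
  have hRs : IsSmoothOpFamily F R := by
    refine ⟨fun σ₀ => ?_, hps⟩
    obtain ⟨N, hN⟩ := hord σ₀
    obtain ⟨n, hn⟩ := hRN σ₀
    refine ⟨max n N, ?_⟩
    filter_upwards [hRd.eventually_isDiffOpLT_sub hN] with σ hσ
    have := (hn.mono (le_max_left n N)).add (hσ.mono (le_max_right n N))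
    have e : R σ₀ + (R σ - R σ₀) = R σ := LinearMap.ext fun g =>
      show R σ₀ g + (R σ g - R σ₀ g) = R σ g by ring
    rwa [e] at this
  refine ⟨fun σ => R σ + P₀, hRs.add (IsSmoothOpFamily.const hP₀), fun g x => ⟨?_, fun σ v => ?_⟩,
    fun σ => ?_⟩
  · exact (hp g x).add (g := fun _ => (P₀ g : M → ℂ) x) mdifferentiable_const
  · refine (mvfderiv_fun_add_apply (hp g x σ)
      (mdifferentiableAt_const (I := 𝓘(ℝ, F)) (c := (P₀ g : M → ℂ) x) (x := σ)) v).trans ?_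
    rw [mvfderiv_const, hpd]
    exact add_zero _
  · exact (congrArg (· + P₀) (hR0 σ)).trans (zero_add P₀)

end OpPrimitive

/-! ### Composition and inversion of formal operators -/

section FormalOperators

theorem sum_antidiagonal_assoc {X : Type*} [AddCommMonoid X] (f : ℕ → ℕ → ℕ → X) (n : ℕ) :
    ∑ p ∈ Finset.HasAntidiagonal.antidiagonal n, ∑ q ∈ Finset.HasAntidiagonal.antidiagonal p.2,
      f p.1 q.1 q.2 =
    ∑ p ∈ Finset.HasAntidiagonal.antidiagonal n, ∑ q ∈ Finset.HasAntidiagonal.antidiagonal p.1,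
      f q.1 q.2 p.2 := by
  simp only [Finset.sum_sigma']
  apply Finset.sum_nbij' (fun ⟨⟨i, _j⟩, ⟨k, l⟩⟩ ↦ ⟨(i + k, l), (i, k)⟩)
    (fun ⟨⟨_i, j⟩, ⟨k, l⟩⟩ ↦ ⟨(k, l + j), (l, j)⟩) <;>
    simp only [Finset.mem_sigma, Finset.HasAntidiagonal.mem_antidiagonal] <;> grind

variable {E : Type*} [NormedAddCommGroup E] [NormedSpace ℝ E]
  {M : Type*} [TopologicalSpace M] [ChartedSpace E M]

/-- Composition of formal operators. -/
def formalComp (P Q : ℕ → Module.End ℂ (SmoothFun E M)) (n : ℕ) : Module.End ℂ (SmoothFun E M) :=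
  ∑ p ∈ Finset.HasAntidiagonal.antidiagonal n, P p.1 * Q p.2

theorem coeff_formalApply (P : ℕ → Module.End ℂ (SmoothFun E M)) (f : FormalFun E M) (n : ℕ) :
    PowerSeries.coeff n (formalApply P f) =
      ∑ p ∈ Finset.HasAntidiagonal.antidiagonal n, P p.1 (PowerSeries.coeff p.2 f) :=
  PowerSeries.coeff_mk _ _

theorem formalApply_comp (P Q : ℕ → Module.End ℂ (SmoothFun E M)) (f : FormalFun E M) :
    formalApply (formalComp P Q) f = formalApply P (formalApply Q f) := by
  ext1 n
  simp only [coeff_formalApply, map_sum, formalComp, LinearMap.sum_apply]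
  exact (sum_antidiagonal_assoc (fun i j k => P i (Q j (PowerSeries.coeff k f))) n).symm

theorem formalApply_zero (P : ℕ → Module.End ℂ (SmoothFun E M)) : formalApply P 0 = 0 := by
  ext1 n
  simp [coeff_formalApply]

theorem formalApply_single (f : FormalFun E M) :
    formalApply (fun n => if n = 0 then 1 else 0) f = f := by
  ext1 n
  rw [coeff_formalApply, Finset.sum_eq_single (0, n)]
  · rfl
  · rintro ⟨i, j⟩ hij hne
    have hi : i ≠ 0 := by
      rintro rfl
      simp_all
    simp only [if_neg hi]
    rfl
  · simp

theorem formalMul_zero_left (c : ℕ → SmoothFun E M →ₗ[ℂ] SmoothFun E M →ₗ[ℂ] SmoothFun E M)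
    (f : FormalFun E M) : formalMul c 0 f = 0 := by
  ext1 n
  simp [formalMul]

theorem formalMul_zero_right (c : ℕ → SmoothFun E M →ₗ[ℂ] SmoothFun E M →ₗ[ℂ] SmoothFun E M)
    (f : FormalFun E M) : formalMul c f 0 = 0 := by
  ext1 n
  simp [formalMul]

/-- The inverse of a formal operator that is the identity modulo `h`. -/
def formalInv (P : ℕ → Module.End ℂ (SmoothFun E M)) (n : ℕ) : Module.End ℂ (SmoothFun E M) :=
  PowerSeries.coeff n (PowerSeries.invOfUnit (PowerSeries.mk P) 1)

theorem formalInv_zero (P : ℕ → Module.End ℂ (SmoothFun E M)) : formalInv P 0 = 1 := by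
  refine (PowerSeries.coeff_invOfUnit 0 (PowerSeries.mk P) 1).trans ?_
  rw [if_pos rfl]
  simp

/-- The recursion writes each coefficient through products of `P` with earlier coefficients, so
smoothness passes to the inverse by strong induction. -/
theorem formalInv_of_ne_zero (P : ℕ → Module.End ℂ (SmoothFun E M)) {n : ℕ} (hn : n ≠ 0) :
    formalInv P n = -∑ p ∈ Finset.HasAntidiagonal.antidiagonal n,
      if p.2 < n then P p.1 * formalInv P p.2 else 0 := by
  refine (PowerSeries.coeff_invOfUnit n (PowerSeries.mk P) 1).trans ?_
  rw [if_neg hn]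
  have h : (∑ p ∈ Finset.HasAntidiagonal.antidiagonal n, if p.2 < n then
      PowerSeries.coeff p.1 (PowerSeries.mk P) *
        PowerSeries.coeff p.2 (PowerSeries.invOfUnit (PowerSeries.mk P) 1) else 0) =
      ∑ p ∈ Finset.HasAntidiagonal.antidiagonal n,
        if p.2 < n then P p.1 * formalInv P p.2 else 0 :=
    Finset.sum_congr rfl fun p _ => by rw [PowerSeries.coeff_mk]; rfl
  exact LinearMap.ext fun g => congrArg (fun Q : Module.End ℂ (SmoothFun E M) => -(Q g)) h

theorem formalApply_formalInv {P : ℕ → Module.End ℂ (SmoothFun E M)} (hP : P 0 = 1)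
    (f : FormalFun E M) : formalApply P (formalApply (formalInv P) f) = f := by
  have h1 : formalComp P (formalInv P) = fun n => if n = 0 then 1 else 0 := by
    ext1 n
    have h := congrArg (PowerSeries.coeff n)
      (PowerSeries.mul_invOfUnit (PowerSeries.mk P) 1 (by simp [hP]))
    rw [PowerSeries.coeff_mul, PowerSeries.coeff_one] at h
    simpa [formalComp, formalInv] using h
  rw [← formalApply_comp, h1, formalApply_single]

theorem formalInv_formalApply {P : ℕ → Module.End ℂ (SmoothFun E M)} (hP : P 0 = 1)
    (f : FormalFun E M) : formalApply (formalInv P) (formalApply P f) = f := by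
  have h1 : formalComp (formalInv P) P = fun n => if n = 0 then 1 else 0 := by
    ext1 n
    have h := congrArg (PowerSeries.coeff n)
      (PowerSeries.invOfUnit_mul (PowerSeries.mk P) 1 (by simp [hP]))
    rw [PowerSeries.coeff_mul, PowerSeries.coeff_one] at h
    simpa [formalComp, formalInv] using h
  rw [← formalApply_comp, h1, formalApply_single]

end FormalOperators

/-! ### Smooth families of formal operators and sections -/

section FormalFamilies

variable {F : Type*} [NormedAddCommGroup F] [NormedSpace ℝ F] [FiniteDimensional ℝ F]
  {T : Type*} [TopologicalSpace T] [ChartedSpace F T] [IsManifold 𝓘(ℝ, F) ∞ T]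
  {E : Type} [NormedAddCommGroup E] [NormedSpace ℝ E] [FiniteDimensional ℝ E]
  {M : Type*} [TopologicalSpace M] [T2Space M] [ChartedSpace E M] [IsManifold 𝓘(ℝ, E) ∞ M]

theorem IsSmoothOpFamily.formalComp {P Q : T → ℕ → Module.End ℂ (SmoothFun E M)}
    (hP : ∀ n, IsSmoothOpFamily F (fun σ => P σ n)) (hQ : ∀ n, IsSmoothOpFamily F (fun σ => Q σ n))
    (n : ℕ) : IsSmoothOpFamily F (fun σ => formalComp (P σ) (Q σ) n) :=
  IsSmoothOpFamily.sum _ fun p _ => (hP p.1).mul (hQ p.2)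

theorem IsSmoothOpFamily.formalInv {P : T → ℕ → Module.End ℂ (SmoothFun E M)}
    (hP : ∀ n, IsSmoothOpFamily F (fun σ => P σ n)) (n : ℕ) :
    IsSmoothOpFamily F (fun σ => formalInv (P σ) n) := by
  induction n using Nat.strong_induction_on with
  | _ n ih =>
    by_cases hn : n = 0
    · subst hn
      simp only [formalInv_zero]
      exact IsSmoothOpFamily.const isDiffOpLT_one
    · simp only [formalInv_of_ne_zero _ hn]
      refine (IsSmoothOpFamily.sum _ fun p _ => ?_).neg
      by_cases hp : p.2 < n
      · simp only [if_pos hp]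
        exact (hP p.1).mul (ih p.2 hp)
      · simp only [if_neg hp]
        exact IsSmoothOpFamily.const (isDiffOpLT_zero 0)

theorem FormalSection.ext_apply {f g : FormalSection F T E M} (h : ∀ σ, f σ = g σ) : f = g := by
  cases f; cases g
  congr
  exact funext h

/-- The action of a smooth family of formal operators on sections. -/
def formalAct (P : T → ℕ → Module.End ℂ (SmoothFun E M))
    (hP : ∀ n, IsSmoothOpFamily F (fun σ => P σ n)) (f : FormalSection F T E M) :
    FormalSection F T E M where
  toFun σ := formalApply (P σ) (f σ)
  smooth n := by
    simp only [coeff_formalApply]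
    exact isSmoothFamily_sum _ fun p _ => (hP p.1).smooth (f.smooth p.2)

variable (F T) in
/-- Constant sections. -/
def constSection (f : FormalFun E M) : FormalSection F T E M where
  toFun _ := f
  smooth n := isSmoothFamily_const (PowerSeries.coeff n f)

/-- The derivative of a section with respect to the trivial connection. -/
def FormalSection.deriv (V : SmoothVectorField F T) (f : FormalSection F T E M) :
    FormalSection F T E M where
  toFun σ := PowerSeries.mk fun n =>
    derivAlong V (fun τ => PowerSeries.coeff n (f τ)) (f.smooth n) σ
  smooth n := by
    simp only [PowerSeries.coeff_mk]
    exact contMDiff_derivAlong V (f.smooth n)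

theorem FormalSection.coeff_deriv_apply (V : SmoothVectorField F T) (f : FormalSection F T E M)
    (n : ℕ) (σ : T) (x : M) : ((PowerSeries.coeff n (f.deriv V σ) : SmoothFun E M) : M → ℂ) x =
      mvfderiv 𝓘(ℝ, F) (fun τ => ((PowerSeries.coeff n (f τ) : SmoothFun E M) : M → ℂ) x) σ (V σ) := by
  simp only [FormalSection.deriv, PowerSeries.coeff_mk]
  rfl

theorem deriv_constSection (V : SmoothVectorField F T) (f : FormalFun E M) (σ : T) :
    (constSection F T f).deriv V σ = 0 := by
  ext n x
  rw [FormalSection.coeff_deriv_apply]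
  simp only [constSection, mvfderiv_const]
  rfl

theorem FormalConnection.covDeriv_apply (D : FormalConnection F T E M) (V : SmoothVectorField F T)
    (f : FormalSection F T E M) (σ : T) :
    D.covDeriv V f σ = f.deriv V σ + formalApply (D.A σ (V σ)) (f σ) := rfl

theorem mvfderiv_fun_sum_apply {α : Type*} (s : Finset α) {f : α → T → ℂ} {σ : T}
    (hf : ∀ a ∈ s, MDifferentiableAt 𝓘(ℝ, F) 𝓘(ℝ, ℂ) (f a) σ) (v : TangentSpace 𝓘(ℝ, F) σ) :
    MDifferentiableAt 𝓘(ℝ, F) 𝓘(ℝ, ℂ) (fun τ => ∑ a ∈ s, f a τ) σ ∧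
    mvfderiv 𝓘(ℝ, F) (fun τ => ∑ a ∈ s, f a τ) σ v = ∑ a ∈ s, mvfderiv 𝓘(ℝ, F) (f a) σ v := by
  classical
  induction s using Finset.induction_on with
  | empty =>
    simp only [Finset.sum_empty, mvfderiv_const]
    exact ⟨mdifferentiableAt_const, rfl⟩
  | insert a s ha ih =>
    obtain ⟨h1, h2⟩ := ih fun b hb => hf b (by simp [hb])
    simp only [Finset.sum_insert ha]
    refine ⟨(hf a (by simp)).add h1, ?_⟩
    rw [← h2]
    exact mvfderiv_fun_add_apply (hf a (by simp)) h1 v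

end FormalFamilies

/-! ### Trivialisations of flat formal connections -/

section Trivialisation

variable {F : Type*} [NormedAddCommGroup F] [NormedSpace ℝ F] [FiniteDimensional ℝ F]
  {T : Type*} [TopologicalSpace T] [ChartedSpace F T] [IsManifold 𝓘(ℝ, F) ∞ T]
  {E : Type} [NormedAddCommGroup E] [NormedSpace ℝ E] [FiniteDimensional ℝ E]
  {M : Type*} [TopologicalSpace M] [ChartedSpace E M] [IsManifold 𝓘(ℝ, E) ∞ M]

/-- The coefficients of `-A ∘ G`. -/
def FormalConnection.negComp (D : FormalConnection F T E M)
    (G : ℕ → T → Module.End ℂ (SmoothFun E M)) (n : ℕ) (σ : T) :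
    TangentSpace 𝓘(ℝ, F) σ →ₗ[ℝ] Module.End ℂ (SmoothFun E M) where
  toFun v := -formalComp (D.A σ v) (fun k => G k σ) n
  map_add' v w := by
    simp only [formalComp, map_add, Pi.add_apply, add_mul, Finset.sum_add_distrib]
    exact neg_add (α := Module.End ℂ (SmoothFun E M)) _ _
  map_smul' r v := by
    simp only [formalComp, map_smul, Pi.smul_apply, smul_mul_assoc, RingHom.id_apply,
      ← Finset.smul_sum]
    exact (smul_neg (A := Module.End ℂ (SmoothFun E M)) r _).symm

theorem FormalConnection.negComp_apply (D : FormalConnection F T E M)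
    (G : ℕ → T → Module.End ℂ (SmoothFun E M)) (n : ℕ) (σ : T) (v : TangentSpace 𝓘(ℝ, F) σ)
    (g : SmoothFun E M) : D.negComp G n σ v g =
      -∑ p ∈ Finset.HasAntidiagonal.antidiagonal n, D.A σ v p.1 (G p.2 σ g) := by
  change -(formalComp (D.A σ v) (fun k => G k σ) n g) = _
  rw [formalComp, LinearMap.sum_apply]
  rfl

/-- As `A` has no term of order zero in `h`, the coefficient `n` of `A G` involves only `G m` with
`m < n`. This turns `dG = -A G` into a recursion. -/
theorem FormalConnection.negComp_congr (D : FormalConnection F T E M)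
    {G G' : ℕ → T → Module.End ℂ (SmoothFun E M)} {n : ℕ} (h : ∀ m < n, G m = G' m) :
    D.negComp G n = D.negComp G' n := by
  ext1 σ
  refine LinearMap.ext fun v => LinearMap.ext fun g => ?_
  rw [D.negComp_apply, D.negComp_apply]
  refine congrArg _ (Finset.sum_congr rfl fun p hp => ?_)
  rw [Finset.HasAntidiagonal.mem_antidiagonal] at hp
  by_cases h0 : p.1 = 0
  · rw [h0, D.A_zero]; rfl
  · rw [h p.2 (by omega)]

theorem FormalConnection.negComp_order (D : FormalConnection F T E M)
    {G : ℕ → T → Module.End ℂ (SmoothFun E M)} (hG : ∀ m, IsSmoothOpFamily F (G m)) (n : ℕ)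
    (σ₀ : T) : ∃ N : ℕ, ∀ᶠ σ in 𝓝 σ₀, ∀ v, IsDiffOpLT N (D.negComp G n σ v) := by
  have key : ∀ s : Finset (ℕ × ℕ), ∃ N : ℕ, ∀ᶠ σ in 𝓝 σ₀, ∀ v,
      IsDiffOpLT N (∑ p ∈ s, D.A σ v p.1 * G p.2 σ) := by
    intro s
    induction s using Finset.induction_on with
    | empty => exact ⟨0, Eventually.of_forall fun σ v => rfl⟩
    | insert p s hp ih =>
      obtain ⟨N, hN⟩ := ih
      obtain ⟨k, hk⟩ := D.isDiffOp p.1 σ₀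
      obtain ⟨l, hl⟩ := (hG p.2).order σ₀
      refine ⟨max (k + 1 + l) N, ?_⟩
      filter_upwards [hN, hk, hl] with σ h1 h2 h3 v
      rw [Finset.sum_insert hp]
      exact (((isDiffOpLT_succ_iff.2 (h2 v)).mul h3).mono (le_max_left _ _)).add
        ((h1 v).mono (le_max_right _ _))
  obtain ⟨N, hN⟩ := key (Finset.HasAntidiagonal.antidiagonal n)
  exact ⟨N, hN.mono fun σ h v => (h v).neg⟩

theorem FormalConnection.negComp_smooth (D : FormalConnection F T E M)
    {G : ℕ → T → Module.End ℂ (SmoothFun E M)} (hG : ∀ m, IsSmoothOpFamily F (G m)) (n : ℕ)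
    (V : SmoothVectorField F T) (g : SmoothFun E M) :
    IsSmoothFamily F (fun σ => D.negComp G n σ (V σ) g) := by
  simp only [D.negComp_apply]
  exact (isSmoothFamily_sum _ fun p _ => D.smooth p.1 V _ ((hG p.2).smooth_const g)).neg

/-- `G` trivialises `D`: it is the identity at the base points, and `dG = -A G`. -/
structure FormalConnection.IsTrivialisation (D : FormalConnection F T E M)
    (G : ℕ → T → Module.End ℂ (SmoothFun E M)) : Prop where
  smooth : ∀ n, IsSmoothOpFamily F (G n)
  deriv : ∀ n, HasOpDeriv (G n) (fun σ v => D.negComp G n σ v)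
  base : ∀ n σ, G n (basePoint σ) = if n = 0 then 1 else 0

/-- At order zero the equation reads `dG_0 = 0`. Hence `G` is invertible as a formal operator. -/
theorem FormalConnection.IsTrivialisation.zero {D : FormalConnection F T E M}
    {G : ℕ → T → Module.End ℂ (SmoothFun E M)} (hG : D.IsTrivialisation G) (σ : T) :
    G 0 σ = 1 := by
  refine LinearMap.ext fun g => Subtype.ext (funext fun x => ?_)
  have h1 := eq_basePoint_of_mvfderiv_eq_zero (hG.deriv 0 g x).1 (fun τ v => ?_) σ
  · rw [hG.base, if_pos rfl] at h1
    exact h1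
  · rw [(hG.deriv 0 g x).2, D.negComp_apply]
    rw [Finset.sum_eq_zero, neg_zero]
    · rfl
    · rintro ⟨i, j⟩ hij
      rw [Finset.HasAntidiagonal.mem_antidiagonal] at hij
      rw [show i = 0 by simp at hij; omega, D.A_zero]
      rfl

variable [T2Space M]

theorem coeff_formalApply_C (P : ℕ → Module.End ℂ (SmoothFun E M)) (g : SmoothFun E M) (n : ℕ) :
    PowerSeries.coeff n (formalApply P (PowerSeries.C g)) = P n g := by
  rw [coeff_formalApply, Finset.sum_eq_single (n, 0)]
  · simp
  · rintro ⟨i, j⟩ hij hne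
    have hj : j ≠ 0 := by
      rintro rfl
      simp_all
    simp [PowerSeries.coeff_C, hj]
  · simp

/-- The lowest order term of the curvature on a section that is parallel to lower order. -/
theorem FormalConnection.negComp_closed (D : FormalConnection F T E M) (hD : D.IsFlat)
    {G : ℕ → T → Module.End ℂ (SmoothFun E M)} {n : ℕ} (hG : ∀ m, IsSmoothOpFamily F (G m))
    (hGd : ∀ m < n, HasOpDeriv (G m) (fun σ v => D.negComp G m σ v)) (hGn : G n = fun _ => 0)
    (V W : SmoothVectorField F T) (g : SmoothFun E M) (x : M) (σ : T) :
    mvfderiv 𝓘(ℝ, F) (fun τ => (D.negComp G n τ (W τ) g : M → ℂ) x) σ (V σ)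
      - mvfderiv 𝓘(ℝ, F) (fun τ => (D.negComp G n τ (V τ) g : M → ℂ) x) σ (W σ)
      - (D.negComp G n σ (VectorField.mlieBracket 𝓘(ℝ, F) V W σ) g : M → ℂ) x = 0 := by
  -- With `G n = 0`, this section satisfies `D_W s = -B(W) g h^n` modulo `h^(n+1)`, where `B` is
  -- `D.negComp G n`.
  let s : FormalSection F T E M := formalAct (fun σ k => G k σ) hG (constSection F T (PowerSeries.C g))
  have hs : ∀ k τ, PowerSeries.coeff k (s τ) = G k τ g := fun k τ =>
    coeff_formalApply_C (fun k => G k τ) g k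
  have hcoeff : ∀ (W : SmoothVectorField F T) (k : ℕ) (τ : T) (y : M),
      ((PowerSeries.coeff k (D.covDeriv W s τ) : SmoothFun E M) : M → ℂ) y =
      mvfderiv 𝓘(ℝ, F) (fun τ => (G k τ g : M → ℂ) y) τ (W τ) -
        (D.negComp G k τ (W τ) g : M → ℂ) y := by
    intro W k τ y
    rw [D.covDeriv_apply, map_add]
    refine (congrArg (· + _) (s.coeff_deriv_apply W k τ y)).trans ?_
    rw [coeff_formalApply, D.negComp_apply]
    simp only [hs]
    exact (sub_neg_eq_add _ _).symm
  have hlt : ∀ (W : SmoothVectorField F T), ∀ k < n, ∀ τ,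
      PowerSeries.coeff k (D.covDeriv W s τ) = 0 := by
    intro W k hk τ
    refine Subtype.ext (funext fun y => ?_)
    rw [hcoeff, (hGd k hk g y).2]
    exact sub_self _
  have hn : ∀ (W : SmoothVectorField F T) (τ : T) (y : M),
      ((PowerSeries.coeff n (D.covDeriv W s τ) : SmoothFun E M) : M → ℂ) y =
        -(D.negComp G n τ (W τ) g : M → ℂ) y := by
    intro W τ y
    rw [hcoeff, hGn]
    change mvfderiv 𝓘(ℝ, F) (fun _ : T => (0 : ℂ)) τ (W τ) - _ = _
    rw [mvfderiv_const]
    exact zero_sub _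
  -- A second covariant derivative only differentiates this leading term, since `A` raises the order
  -- in `h`. Coefficient `n` of the curvature on `s` is therefore `-dB(V, W) g`.
  have h2 : ∀ V W : SmoothVectorField F T,
      ((PowerSeries.coeff n (D.covDeriv V (D.covDeriv W s) σ) : SmoothFun E M) : M → ℂ) x =
      -mvfderiv 𝓘(ℝ, F) (fun τ => (D.negComp G n τ (W τ) g : M → ℂ) x) σ (V σ) := by
    intro V W
    rw [D.covDeriv_apply, map_add]
    have h3 : PowerSeries.coeff n (formalApply (D.A σ (V σ)) (D.covDeriv W s σ)) = 0 := by
      rw [coeff_formalApply]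
      refine Finset.sum_eq_zero fun p hp => ?_
      rw [Finset.HasAntidiagonal.mem_antidiagonal] at hp
      by_cases h0 : p.1 = 0
      · rw [h0, D.A_zero]; rfl
      · rw [hlt W p.2 (by omega), map_zero]
    rw [h3, add_zero, FormalSection.coeff_deriv_apply]
    simp only [hn]
    exact congrArg (fun A : TangentSpace 𝓘(ℝ, F) σ →L[ℝ] ℂ => A (V σ)) mvfderiv_neg
  have hflat := congrArg (fun f : FormalFun E M => ((PowerSeries.coeff n f : SmoothFun E M) : M → ℂ) x) (hD V W s σ)
  simp only [map_sub, map_zero] at hflat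
  change ((PowerSeries.coeff n (D.covDeriv V (D.covDeriv W s) σ) : SmoothFun E M) : M → ℂ) x -
    ((PowerSeries.coeff n (D.covDeriv W (D.covDeriv V s) σ) : SmoothFun E M) : M → ℂ) x -
    ((PowerSeries.coeff n (D.covDeriv (V.bracket W) s σ) : SmoothFun E M) : M → ℂ) x = 0 at hflat
  rw [h2, h2, hn] at hflat
  change _ - _ - -(D.negComp G n σ (VectorField.mlieBracket 𝓘(ℝ, F) V W σ) g : M → ℂ) x = 0 at hflat
  linear_combination -hflat

/-- Strong recursion for sequences subject to conditions on the previous terms. -/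
theorem exists_seq_of_forall_lt {X : Type*} [Nonempty X] (R : ℕ → (ℕ → X) → X → Prop)
    (hcongr : ∀ n a b x, (∀ m < n, a m = b m) → R n a x → R n b x)
    (hex : ∀ n a, (∀ m < n, R m a (a m)) → ∃ x, R n a x) : ∃ a, ∀ n, R n a (a n) := by
  classical
  let x₀ : X := Classical.arbitrary X
  let f : ℕ → (ℕ → X) → X := fun n a => if h : ∃ x, R n a x then h.choose else x₀
  let a : ℕ → X := fun n => Nat.strongRec (motive := fun _ => X)
    (fun n prev => f n fun m => if h : m < n then prev m h else x₀) n
  -- The recursion supplies only terms below `n`; the default value beyond them is harmless by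
  -- `hcongr`.
  let t : ℕ → ℕ → X := fun n m => if m < n then a m else x₀
  have ha : ∀ n, a n = f n (t n) := by
    intro n
    have : a n = f n fun m => if h : m < n then a m else x₀ := by
      simp only [a]
      rw [Nat.strongRec_eq]
    rw [this]
    rfl
  have ht : ∀ n, ∀ m < n, t n m = a m := fun n m hm => if_pos hm
  refine ⟨a, fun n => ?_⟩
  induction n using Nat.strong_induction_on with
  | _ n ih =>
    have h1 : ∃ x, R n (t n) x := by
      refine hex n (t n) fun m hm => ?_
      rw [ht n m hm]
      exact hcongr m a _ _ (fun k hk => (ht n k (hk.trans hm)).symm) (ih m hm)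
    refine hcongr n (t n) a _ (ht n) ?_
    rw [ha]
    simp only [f, dif_pos h1]
    exact h1.choose_spec

theorem FormalConnection.exists_isTrivialisation [T2Space T] (hT : Subsingleton (deRhamH1 F T))
    (D : FormalConnection F T E M) (hD : D.IsFlat) :
    ∃ G : ℕ → T → Module.End ℂ (SmoothFun E M), D.IsTrivialisation G := by
  classical
  suffices h : ∃ G : ℕ → T → Module.End ℂ (SmoothFun E M), ∀ n, IsSmoothOpFamily F (G n) ∧
      HasOpDeriv (G n) (fun σ v => D.negComp G n σ v) ∧
      ∀ σ, G n (basePoint σ) = if n = 0 then 1 else 0 by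
    obtain ⟨G, hG⟩ := h
    exact ⟨G, fun n => (hG n).1, fun n => (hG n).2.1, fun n => (hG n).2.2⟩
  refine exists_seq_of_forall_lt (X := T → Module.End ℂ (SmoothFun E M))
    (fun n G Q => IsSmoothOpFamily F Q ∧ HasOpDeriv Q (fun σ v => D.negComp G n σ v) ∧
      ∀ σ, Q (basePoint σ) = if n = 0 then 1 else 0) ?_ ?_
  · intro n G G' Q h hQ
    rwa [D.negComp_congr h] at hQ
  · intro n G hG
    -- Terms from `n` on are set to zero: the family is then smooth at every index and `G' n = 0`,
    -- as `negComp_closed` requires. By `negComp_congr` the form at order `n` is unaffected.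
    let G' : ℕ → T → Module.End ℂ (SmoothFun E M) := fun m => if m < n then G m else fun _ => 0
    have hG' : ∀ m < n, G' m = G m := fun m hm => if_pos hm
    have hs : ∀ m, IsSmoothOpFamily F (G' m) := by
      intro m
      by_cases hm : m < n
      · rw [hG' m hm]; exact (hG m hm).1
      · simp only [G', if_neg hm]
        exact IsSmoothOpFamily.const (isDiffOpLT_zero 0)
    have hd : ∀ m < n, HasOpDeriv (G' m) (fun σ v => D.negComp G' m σ v) := by
      intro m hm
      rw [hG' m hm, D.negComp_congr fun k hk => hG' k (hk.trans hm)]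
      exact (hG m hm).2.1
    have hP₀ : IsDiffOpLT 1 (if n = 0 then 1 else 0 : Module.End ℂ (SmoothFun E M)) := by
      split_ifs
      · exact isDiffOpLT_one
      · exact isDiffOpLT_zero 1
    obtain ⟨Q, h1, h2, h3⟩ := exists_smoothOpFamily hT (D.negComp G' n) (D.negComp_order hs n)
      (D.negComp_smooth hs n)
      (fun V W g x σ => D.negComp_closed hD hs hd (if_neg (lt_irrefl n)) V W g x σ) hP₀
    rw [D.negComp_congr hG'] at h2
    exact ⟨Q, h1, h2, h3⟩

end Trivialisation

/-! ### Uniqueness up to gauge equivalence -/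

section Gauge

variable {F : Type*} [NormedAddCommGroup F] [NormedSpace ℝ F] [FiniteDimensional ℝ F]
  {T : Type*} [TopologicalSpace T] [T2Space T] [ChartedSpace F T] [IsManifold 𝓘(ℝ, F) ∞ T]
  {E : Type} [NormedAddCommGroup E] [NormedSpace ℝ E] [FiniteDimensional ℝ E]
  {M : Type*} [TopologicalSpace M] [T2Space M] [ChartedSpace E M] [IsManifold 𝓘(ℝ, E) ∞ M]

/-- Covariant derivatives are taken along global fields, whereas local constancy needs the
derivative along every tangent vector; this passes from one to the other. -/
theorem exists_vectorField_mvfderiv_eq (σ : T) (v : TangentSpace 𝓘(ℝ, F) σ) :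
    ∃ V : SmoothVectorField F T, ∀ h : T → ℂ, MDifferentiableAt 𝓘(ℝ, F) 𝓘(ℝ, ℂ) h σ →
      mvfderiv 𝓘(ℝ, F) h σ v = mvfderiv 𝓘(ℝ, F) h σ (V σ) := by
  obtain ⟨ψ, hψ, -⟩ := exists_isLocalParam (E := F) σ (univ_mem (f := 𝓝 σ))
  obtain ⟨w, hw⟩ := hψ.exists_mfderiv_eq v
  obtain ⟨V, hV⟩ := hψ.exists_vectorField w
  refine ⟨V, fun h hh => ?_⟩
  have hh' : MDifferentiableAt 𝓘(ℝ, F) 𝓘(ℝ, ℂ) h (ψ (chartAt F σ σ)) := by rwa [hψ.apply_chart]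
  have h1 := mfderiv_comp_apply (chartAt F σ σ) hh' (hψ.contMDiff.mdifferentiable (by simp) _) w
  rw [← hV.self_of_nhds, mfderiv_eq_fderiv] at h1
  -- The type of the tangent vector depends on its base point, so the equality of points is
  -- eliminated by substitution.
  have h2 : ∀ τ, τ = σ → mvfderiv 𝓘(ℝ, F) h τ (V τ) = mvfderiv 𝓘(ℝ, F) h σ (V σ) := by
    rintro _ rfl; rfl
  exact (hw h hh).symm.trans (h1.trans (h2 _ hψ.apply_chart))

namespace FormalConnection.IsTrivialisation

variable {D : FormalConnection F T E M} {G : ℕ → T → Module.End ℂ (SmoothFun E M)}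

/-- In the frame `G` the connection becomes trivial: `D(G u) = (dG + A G) u + G du`, and the bracket
vanishes. -/
theorem covDeriv_formalAct (hG : D.IsTrivialisation G) (V : SmoothVectorField F T)
    (u : FormalSection F T E M) (σ : T) :
    D.covDeriv V (formalAct (fun σ k => G k σ) hG.smooth u) σ =
      formalApply (fun k => G k σ) (u.deriv V σ) := by
  ext n x
  rw [D.covDeriv_apply, map_add]
  refine (congrArg (· + _) (FormalSection.coeff_deriv_apply V
    (formalAct (fun σ k => G k σ) hG.smooth u) n σ x)).trans ?_
  have e1 : (fun τ => ((PowerSeries.coeff n (formalAct (fun σ k => G k σ) hG.smooth u τ) :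
      SmoothFun E M) : M → ℂ) x) = fun τ => ∑ p ∈ Finset.HasAntidiagonal.antidiagonal n,
        (G p.1 τ (PowerSeries.coeff p.2 (u τ)) : M → ℂ) x := by
    ext τ
    change ((PowerSeries.coeff n (formalApply _ (u τ)) : SmoothFun E M) : M → ℂ) x = _
    rw [coeff_formalApply, AddSubmonoidClass.coe_finsetSum, Finset.sum_apply]
  rw [e1, (mvfderiv_fun_sum_apply _
    (fun p _ => ((hG.smooth p.1).smooth (u.smooth p.2)).mdifferentiable x σ) _).2]
  have e2 : ∀ p : ℕ × ℕ, mvfderiv 𝓘(ℝ, F)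
      (fun τ => (G p.1 τ (PowerSeries.coeff p.2 (u τ)) : M → ℂ) x) σ (V σ) =
      (D.negComp G p.1 σ (V σ) (PowerSeries.coeff p.2 (u σ)) : M → ℂ) x +
        (G p.1 σ (PowerSeries.coeff p.2 (u.deriv V σ)) : M → ℂ) x := by
    intro p
    rw [(hG.smooth p.1).mvfderiv_apply (u.smooth p.2) V σ x, (hG.deriv p.1 _ x).2,
      FormalSection.deriv, PowerSeries.coeff_mk]
  simp only [e2]
  rw [Finset.sum_add_distrib]
  have e3 : ∑ p ∈ Finset.HasAntidiagonal.antidiagonal n,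
      D.negComp G p.1 σ (V σ) (PowerSeries.coeff p.2 (u σ)) +
      PowerSeries.coeff n (formalApply (D.A σ (V σ)) (formalApply (fun k => G k σ) (u σ))) = 0 := by
    rw [← formalApply_comp, coeff_formalApply, ← Finset.sum_add_distrib]
    exact Finset.sum_eq_zero fun p _ => neg_add_cancel _
  have e4 := congrArg (fun f : SmoothFun E M => (f : M → ℂ) x) e3
  change ((∑ p ∈ Finset.HasAntidiagonal.antidiagonal n,
      D.negComp G p.1 σ (V σ) (PowerSeries.coeff p.2 (u σ)) : SmoothFun E M) : M → ℂ) x +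
      ((PowerSeries.coeff n (formalApply (D.A σ (V σ)) (formalApply (fun k => G k σ) (u σ))) :
        SmoothFun E M) : M → ℂ) x = 0 at e4
  rw [AddSubmonoidClass.coe_finsetSum, Finset.sum_apply] at e4
  rw [coeff_formalApply (fun k => G k σ), AddSubmonoidClass.coe_finsetSum, Finset.sum_apply]
  change _ + ((PowerSeries.coeff n (formalApply (D.A σ (V σ))
    (formalApply (fun k => G k σ) (u σ))) : SmoothFun E M) : M → ℂ) x = _
  linear_combination e4

theorem smooth_inv (hG : D.IsTrivialisation G) (n : ℕ) :
    IsSmoothOpFamily F (fun σ => formalInv (fun k => G k σ) n) :=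
  IsSmoothOpFamily.formalInv (P := fun σ k => G k σ) hG.smooth n

theorem apply_inv (hG : D.IsTrivialisation G) (σ : T) (f : FormalFun E M) :
    formalApply (fun k => G k σ) (formalApply (formalInv fun k => G k σ) f) = f :=
  formalApply_formalInv (hG.zero σ) f

theorem inv_apply (hG : D.IsTrivialisation G) (σ : T) (f : FormalFun E M) :
    formalApply (formalInv fun k => G k σ) (formalApply (fun k => G k σ) f) = f :=
  formalInv_formalApply (hG.zero σ) f

theorem apply_basePoint (hG : D.IsTrivialisation G) (σ : T) (f : FormalFun E M) :
    formalApply (fun k => G k (basePoint σ)) f = f := by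
  simp only [hG.base]
  exact formalApply_single f

/-- A section with vanishing covariant derivative is determined by its value at the base point. -/
theorem eq_of_covDeriv_eq_zero (hG : D.IsTrivialisation G) {s : FormalSection F T E M}
    (hs : ∀ V σ, D.covDeriv V s σ = 0) (σ : T) :
    s σ = formalApply (fun k => G k σ) (s (basePoint σ)) := by
  -- In the frame `G` the parallel section becomes `u = G⁻¹ s` with `du = 0`, hence constant on
  -- components.
  let u := formalAct (fun σ => formalInv fun k => G k σ) hG.smooth_inv s
  have hu : formalAct (fun σ k => G k σ) hG.smooth u = s :=
    FormalSection.ext_apply fun σ => hG.apply_inv σ (s σ)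
  have hd : ∀ V σ, u.deriv V σ = 0 := by
    intro V σ
    have h1 := hG.covDeriv_formalAct V u σ
    rw [hu, hs] at h1
    rw [← hG.inv_apply σ (u.deriv V σ), ← h1, formalApply_zero]
  have hc : u σ = u (basePoint σ) := by
    ext n x
    refine eq_basePoint_of_mvfderiv_eq_zero (F := F)
      (h := fun τ => ((PowerSeries.coeff n (u τ) : SmoothFun E M) : M → ℂ) x)
      ((u.smooth n).mdifferentiable x) (fun τ v => ?_) σ
    obtain ⟨V, hV⟩ := exists_vectorField_mvfderiv_eq τ v
    rw [hV _ ((u.smooth n).mdifferentiable x τ), ← FormalSection.coeff_deriv_apply, hd]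
    rfl
  have h1 : s σ = formalApply (fun k => G k σ) (u σ) := (hG.apply_inv σ (s σ)).symm
  have h2 : s (basePoint σ) = u (basePoint σ) := by
    rw [← hG.apply_basePoint σ (u (basePoint σ))]
    exact (hG.apply_inv (basePoint σ) (s (basePoint σ))).symm
  rw [h1, hc, h2]

/-- A trivialisation of a compatible connection intertwines the star products. -/
theorem mul_apply (hG : D.IsTrivialisation G) {Ω : SymplecticForm E M} {star : T → StarProduct Ω}
    (hD : D.IsCompatible star) (σ : T) (f g : FormalFun E M) :
    (star σ).mul (formalApply (fun k => G k σ) f) (formalApply (fun k => G k σ) g) =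
      formalApply (fun k => G k σ) ((star (basePoint σ)).mul f g) := by
  -- `s f` is the parallel section with value `f` at every base point. By compatibility, `s f ⋆ s g`
  -- is parallel with value `f ⋆ g` there.
  let s : FormalFun E M → FormalSection F T E M := fun f =>
    formalAct (fun σ k => G k σ) hG.smooth (constSection F T f)
  have hs : ∀ f V τ, D.covDeriv V (s f) τ = 0 := fun f V τ => by
    rw [hG.covDeriv_formalAct, deriv_constSection, formalApply_zero]
  obtain ⟨fg, h1, h2⟩ := hD (s f) (s g)
  have h3 : ∀ V τ, D.covDeriv V fg τ = 0 := fun V τ => by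
    rw [h2, hs, hs, StarProduct.mul, StarProduct.mul, formalMul_zero_left, formalMul_zero_right,
      add_zero]
  have h4 := hG.eq_of_covDeriv_eq_zero h3 σ
  rw [h1, h1] at h4
  refine h4.trans ?_
  have h5 : ∀ f, s f (basePoint σ) = f := fun f => hG.apply_basePoint σ f
  rw [h5, h5]

end FormalConnection.IsTrivialisation

/-- The gauge transformation is `P = G G'⁻¹`: transport by `D'` back to the base point, then by `D`
out again. It is multiplicative because both transports start from the same star product at the base
point. -/
theorem gaugeEquivalent_of_isTrivialisation {Ω : SymplecticForm E M} {star : T → StarProduct Ω}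
    {D D' : FormalConnection F T E M} {G G' : ℕ → T → Module.End ℂ (SmoothFun E M)}
    (hG : D.IsTrivialisation G) (hG' : D'.IsTrivialisation G') (hD : D.IsCompatible star)
    (hD' : D'.IsCompatible star) : GaugeEquivalent star D D' := by
  have hP := IsSmoothOpFamily.formalComp (P := fun σ k => G k σ) hG.smooth hG'.smooth_inv
  have hP' := IsSmoothOpFamily.formalComp (P := fun σ k => G' k σ) hG'.smooth hG.smooth_inv
  let P : SelfEquivalence F star :=
    { P := fun σ => formalComp (fun k => G k σ) (formalInv fun k => G' k σ)
      P_zero := fun σ => by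
        simp [formalComp, hG.zero, formalInv_zero]
      isDiffOp := fun k σ₀ => by
        obtain ⟨N, hN⟩ := (hP k).order σ₀
        -- `IsDiffOp N` means order less than `N + 1`, so the bound is weakened by one.
        exact ⟨N, hN.mono fun σ h => isDiffOpLT_succ_iff.1 h.succ⟩
      smooth := fun k f hf => (hP k).smooth hf
      map_mul := fun σ f g => by
        simp only [formalApply_comp]
        rw [hG.mul_apply hD, ← hG'.inv_apply σ ((star (basePoint σ)).mul _ _),
          ← hG'.mul_apply hD', hG'.apply_inv, hG'.apply_inv] }
  have hPa : ∀ f σ, P.apply f σ =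
      formalApply (fun k => G k σ) (formalApply (formalInv fun k => G' k σ) (f σ)) :=
    fun f σ => formalApply_comp _ _ _
  let Pinv : FormalSection F T E M → FormalSection F T E M := formalAct _ hP'
  have hPi : ∀ f σ, Pinv f σ =
      formalApply (fun k => G' k σ) (formalApply (formalInv fun k => G k σ) (f σ)) :=
    fun f σ => formalApply_comp _ _ _
  refine ⟨P, Pinv, fun f => FormalSection.ext_apply fun σ => ?_,
    fun f => FormalSection.ext_apply fun σ => ?_, fun V f => FormalSection.ext_apply fun σ => ?_⟩
  · rw [hPi, hPa, hG.inv_apply, hG'.apply_inv]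
  · rw [hPa, hPi, hG'.inv_apply, hG.apply_inv]
  -- Writing `f = G' u` gives `P f = G u`; then `P⁻¹ D (G u) = G' G⁻¹ G du = G' du = D' f`.
  · let u := formalAct (fun σ => formalInv fun k => G' k σ) hG'.smooth_inv f
    have h1 : f = formalAct (fun σ k => G' k σ) hG'.smooth u :=
      FormalSection.ext_apply fun σ => (hG'.apply_inv σ (f σ)).symm
    have h2 : P.apply f = formalAct (fun σ k => G k σ) hG.smooth u :=
      FormalSection.ext_apply fun σ => hPa f σ
    rw [hPi, h2, hG.covDeriv_formalAct, hG.inv_apply]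
    conv_lhs => rw [h1]
    rw [hG'.covDeriv_formalAct]

end Gauge

end

end FormalHitchin

theorem mainTheorem6 {n : ℕ}
    -- the compact symplectic manifold `(M, Ω)` of dimension `2 n`
    {M : Type*} [TopologicalSpace M] [T2Space M] [CompactSpace M]
    [ChartedSpace (EuclideanSpace ℝ (Fin (2 * n))) M] [IsManifold (𝓡 (2 * n)) ∞ M]
    [MeasurableSpace M] [BorelSpace M]
    (Ω : FormalHitchin.SymplecticForm (EuclideanSpace ℝ (Fin (2 * n))) M)
    -- a prequantum line bundle
    {ι : Type*} (L : FormalHitchin.PrequantumBundle Ω ι)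
    -- the parameter manifold `T`, with `H¹(T, ℝ) = 0`
    {F : Type*} [NormedAddCommGroup F] [NormedSpace ℝ F] [FiniteDimensional ℝ F]
    {T : Type*} [TopologicalSpace T] [T2Space T] [SecondCountableTopology T]
    [ChartedSpace F T] [IsManifold 𝓘(ℝ, F) ∞ T]
    (hT : Subsingleton (FormalHitchin.deRhamH1 F T))
    -- the family of Kähler structures and its family of Berezin-Toeplitz star products
    (K : FormalHitchin.KahlerFamily Ω F T) (star : T → FormalHitchin.StarProduct Ω)
    (hstar : ∀ σ, L.IsBerezinToeplitz (K.J σ) (star σ))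
    -- two formal Hitchin connections
    (D D' : FormalHitchin.FormalConnection F T (EuclideanSpace ℝ (Fin (2 * n))) M)
    (hD : D.IsFlatCompatible star)
    (hD' : D'.IsFlatCompatible star) :
    FormalHitchin.GaugeEquivalent star D D' := by
  obtain ⟨G, hG⟩ := D.exists_isTrivialisation hT hD.isFlat
  obtain ⟨G', hG'⟩ := D'.exists_isTrivialisation hT hD'.isFlat
  exact FormalHitchin.gaugeEquivalent_of_isTrivialisation hG hG' hD.isCompatible hD'.isCompatible
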